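/- Let $N$ be a smooth surface (a Hausdorff smooth manifold of real dimension 2 without boundary) with an almost Hermitian structure $(J,\bar g)$, i.e. a smooth Riemannian metric $\bar g$ and a smooth field $J$ of endomorphisms of the tangent spaces with $J^2=-\mathrm{Id}$ and $\bar g(JX,JY)=\bar g(X,Y)$. Then $N$ is automatically Kähler: $\bar\nabla J=0$ for the Levi-Civita connection $\bar\nabla$ of $\bar g$. Let moreover $U\subseteq\mathbf R$ be an open set (for instance an open interval) with coordinate $\theta$, and let $f:U\to(0,\infty)$ be a smooth function with $f''=-f$. On the warped product $M=U\times_f N$, i.e. on the product manifold $U\times N$ with the metric $g=d\theta^2+f(\theta)^2\bar g$, consider the almost contact metric structure $(\varphi,\xi,\eta,g)$ with $\xi=\partial/\partial\theta$, $\eta=d\theta$, $\varphi\,\partial/\partial\theta=0$ and $\varphi X=JX$ for $X$ tangent to $N$. Let $R_{XY}Z=\nabla_X\nabla_YZ-\nabla_Y\nabla_XZ-\nabla_{[X,Y]}Z$, where $\nabla$ is the Levi-Civita connection of $g$, and $R(X,Y,Z,W)=-g(R_{XY}Z,W)$. Then $M$ satisfies the identity (G1): $$R(X,Y,\varphi Z,\varphi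 W)-R(X,Y,Z,W)=g(Y,\varphi W)\,g(X,\varphi Z)-g(X,\varphi W)\,g(Y,\varphi Z)+g(X,W)\,g(Y,Z)-g(Y,W)\,g(X,Z)$$ for all smooth vector fields $X,Y,Z,W$ on $M$. -/

import Mathlib

open Manifold VectorField
open scoped ContDiff Topology

noncomputable section
section LeviCivita

variable {E : Type*} [NormedAddCommGroup E] [NormedSpace ℝ E] [FiniteDimensional ℝ E]
  {H : Type*} [TopologicalSpace H] {I : ModelWithCorners ℝ E H}
  {M : Type*} [TopologicalSpace M] [ChartedSpace H M] [IsManifold I ∞ M]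

variable (I M) in
/-- A smooth Riemannian metric on the manifold `M`. -/
abbrev RiemannianMetricOn : Type _ :=
  Bundle.ContMDiffRiemannianMetric I ∞ E (fun x : M => TangentSpace I x)

set_option linter.unusedSectionVars false in
lemma RiemannianMetricOn.mdiff (g : RiemannianMetricOn I M) {X Y : Π x : M, TangentSpace I x}
    {x : M} (hX : MDiffAt (T% X) x) (hY : MDiffAt (T% Y) x) :
    MDiffAt (fun y => g.inner y (X y) (Y y)) x := by
  have : MDifferentiableAt I (I.prod 𝓘(ℝ, ℝ))
      (fun m ↦ Bundle.TotalSpace.mk' ℝ (E := Bundle.Trivial M ℝ) m (g.inner m (X m) (Y m))) x := by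
    apply MDifferentiableAt.clm_bundle_apply₂ (F₁ := E) (F₂ := E)
    · exact g.contMDiff.mdifferentiable (by simp) x
    · exact hX
    · exact hY
  simp only [mdifferentiableAt_totalSpace] at this
  exact this.2

/-- The right-hand side of the Koszul formula for `2 g(∇_X Y, Z)`. -/
def koszul (g : RiemannianMetricOn I M) (X Y Z : Π x : M, TangentSpace I x) (x : M) : ℝ :=
  d% (fun y => g.inner y (Y y) (Z y)) x (X x)
  + d% (fun y => g.inner y (X y) (Z y)) x (Y x)
  - d% (fun y => g.inner y (X y) (Y y)) x (Z x)
  + g.inner x (mlieBracket I X Y x) (Z x)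
  - g.inner x (mlieBracket I X Z x) (Y x)
  - g.inner x (mlieBracket I Y Z x) (X x)

variable (g : RiemannianMetricOn I M) {X Y Z X' Y' Z' : Π x : M, TangentSpace I x} {x : M}
  {f : M → ℝ}

lemma koszul_add₂ (hX : MDiffAt (T% X) x) (hY : MDiffAt (T% Y) x) (hY' : MDiffAt (T% Y') x)
    (hZ : MDiffAt (T% Z) x) :
    koszul g X (Y + Y') Z x = koszul g X Y Z x + koszul g X Y' Z x := by
  simp only [koszul, Pi.add_apply, map_add, _root_.add_apply,
    mlieBracket_add_left hY hY', mlieBracket_add_right (V := X) hY hY',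
    mvfderiv_fun_add (g.mdiff hY hZ) (g.mdiff hY' hZ),
    mvfderiv_fun_add (g.mdiff hX hY) (g.mdiff hX hY')]
  ring

lemma koszul_smul₂ (hX : MDiffAt (T% X) x) (hY : MDiffAt (T% Y) x) (hf : MDiffAt f x)
    (hZ : MDiffAt (T% Z) x) :
    koszul g X (f • Y) Z x
      = f x * koszul g X Y Z x + 2 * (d% f x (X x) * g.inner x (Y x) (Z x)) := by
  simp only [koszul, Pi.smul_apply', map_smul, _root_.smul_apply, smul_eq_mul,
    mlieBracket_smul_left hf hY, mlieBracket_smul_right (V := X) hf hY,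
    mvfderiv_fun_mul hf (g.mdiff hY hZ), map_add, _root_.add_apply,
    mvfderiv_fun_mul hf (g.mdiff hX hY)]
  rw [g.symm x (Y x) (X x)]
  ring

lemma koszul_add₁ (hX : MDiffAt (T% X) x) (hX' : MDiffAt (T% X') x) (hY : MDiffAt (T% Y) x)
    (hZ : MDiffAt (T% Z) x) :
    koszul g (X + X') Y Z x = koszul g X Y Z x + koszul g X' Y Z x := by
  simp only [koszul, Pi.add_apply, map_add, _root_.add_apply,
    mlieBracket_add_left hX hX',
    mvfderiv_fun_add (g.mdiff hX hZ) (g.mdiff hX' hZ),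
    mvfderiv_fun_add (g.mdiff hX hY) (g.mdiff hX' hY)]
  ring

lemma koszul_smul₁ (hX : MDiffAt (T% X) x) (hY : MDiffAt (T% Y) x) (hf : MDiffAt f x)
    (hZ : MDiffAt (T% Z) x) :
    koszul g (f • X) Y Z x = f x * koszul g X Y Z x := by
  simp only [koszul, Pi.smul_apply', map_smul, _root_.smul_apply, smul_eq_mul,
    mlieBracket_smul_left hf hX,
    mvfderiv_fun_mul hf (g.mdiff hX hZ), map_add, _root_.add_apply,
    mvfderiv_fun_mul hf (g.mdiff hX hY)]
  rw [g.symm x (X x) (Z x), g.symm x (X x) (Y x)]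
  ring

lemma koszul_add₃ (hX : MDiffAt (T% X) x) (hY : MDiffAt (T% Y) x) (hZ : MDiffAt (T% Z) x)
    (hZ' : MDiffAt (T% Z') x) :
    koszul g X Y (Z + Z') x = koszul g X Y Z x + koszul g X Y Z' x := by
  simp only [koszul, Pi.add_apply, map_add, _root_.add_apply,
    mlieBracket_add_right (V := X) hZ hZ', mlieBracket_add_right (V := Y) hZ hZ',
    mvfderiv_fun_add (g.mdiff hX hZ) (g.mdiff hX hZ'),
    mvfderiv_fun_add (g.mdiff hY hZ) (g.mdiff hY hZ')]
  ring

lemma koszul_smul₃ (hX : MDiffAt (T% X) x) (hY : MDiffAt (T% Y) x) (hf : MDiffAt f x)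
    (hZ : MDiffAt (T% Z) x) :
    koszul g X Y (f • Z) x = f x * koszul g X Y Z x := by
  simp only [koszul, Pi.smul_apply', map_smul, _root_.smul_apply, smul_eq_mul,
    mlieBracket_smul_right (V := X) hf hZ, mlieBracket_smul_right (V := Y) hf hZ,
    mvfderiv_fun_mul hf (g.mdiff hX hZ), map_add, _root_.add_apply,
    mvfderiv_fun_mul hf (g.mdiff hY hZ)]
  rw [g.symm x (Z x) (Y x), g.symm x (Z x) (X x)]
  ring

set_option linter.unusedSectionVars false in
lemma RiemannianMetricOn.eq_of_forall {u w : TangentSpace I x}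
    (h : ∀ z, g.inner x u z = g.inner x w z) : u = w := by
  by_contra hne
  have := g.pos x (u - w) (sub_ne_zero.2 hne)
  simp [h] at this

lemma RiemannianMetricOn.exists_sharp (Φ : TangentSpace I x →L[ℝ] TangentSpace I x →L[ℝ] ℝ) :
    ∃ L : TangentSpace I x →L[ℝ] TangentSpace I x, ∀ v z, g.inner x (L v) z = Φ v z := by
  have : FiniteDimensional ℝ (TangentSpace I x) := inferInstanceAs (FiniteDimensional ℝ E)
  have : T2Space (TangentSpace I x) := inferInstanceAs (T2Space E)
  let B : TangentSpace I x →ₗ[ℝ] Module.Dual ℝ (TangentSpace I x) :=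
    ContinuousLinearMap.coeLM ℝ ∘ₗ (g.inner x).toLinearMap
  have hB : Function.Injective B := fun u w h => g.eq_of_forall fun z => congr($h z)
  let S := LinearEquiv.ofInjectiveOfFinrankEq B hB (Subspace.dual_finrank_eq).symm
  refine ⟨LinearMap.toContinuousLinearMap
    (S.symm.toLinearMap ∘ₗ ContinuousLinearMap.coeLM ℝ ∘ₗ Φ.toLinearMap), fun v z => ?_⟩
  have : B (S.symm (ContinuousLinearMap.coeLM ℝ (Φ v))) = ContinuousLinearMap.coeLM ℝ (Φ v) :=
    S.apply_symm_apply _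
  exact congr($this z)

/-- `∇` is a Levi-Civita connection of `g`: it is torsion free and `∇ g = 0`. -/
def IsLeviCivita (cov : CovariantDerivative I E (TangentSpace I : M → Type _)) : Prop :=
  cov.torsion = 0 ∧
  ∀ {x : M} {X Y Z : Π x : M, TangentSpace I x},
    MDiffAt (T% X) x → MDiffAt (T% Y) x → MDiffAt (T% Z) x →
      d% (fun y => g.inner y (Y y) (Z y)) x (X x) =
        g.inner x (cov Y x (X x)) (Z x) + g.inner x (Y x) (cov Z x (X x))

/-- The fundamental theorem of Riemannian geometry (existence). -/
theorem exists_isLeviCivita : ∃ cov : CovariantDerivative I E (TangentSpace I : M → Type _),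
    IsLeviCivita g cov := by
  classical
  have key (Y : Π x : M, TangentSpace I x) (x : M) :
      ∃ L : TangentSpace I x →L[ℝ] TangentSpace I x, MDiffAt (T% Y) x →
        ∀ X Z : Π x : M, TangentSpace I x, MDiffAt (T% X) x → MDiffAt (T% Z) x →
          2 * g.inner x (L (X x)) (Z x) = koszul g X Y Z x := by
    by_cases hY : MDiffAt (T% Y) x
    swap
    · exact ⟨0, fun h => absurd h hY⟩
    have h₁ : ∀ Z : Π x : M, TangentSpace I x, MDiffAt (T% Z) x →
        TensorialAt I E (fun X => koszul g X Y Z x) x := fun Z hZ =>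
      ⟨fun hf hX => koszul_smul₁ g hX hY hf hZ, fun hX hX' => koszul_add₁ g hX hX' hY hZ⟩
    have h₂ : ∀ X : Π x : M, TangentSpace I x, MDiffAt (T% X) x →
        TensorialAt I E (fun Z => koszul g X Y Z x) x := fun X hX =>
      ⟨fun hf hZ => koszul_smul₃ g hX hY hf hZ, fun hZ hZ' => koszul_add₃ g hX hY hZ hZ'⟩
    obtain ⟨L, hL⟩ := g.exists_sharp ((1 / 2 : ℝ) • TensorialAt.mkHom₂ _ x h₁ h₂)
    refine ⟨L, fun _ X Z hX hZ => ?_⟩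
    rw [hL]
    have := TensorialAt.mkHom₂_apply h₁ h₂ hX hZ
    simp [this]
  choose L hL using key
  have ext' {x : M} {A B : TangentSpace I x →L[ℝ] TangentSpace I x}
      (h : ∀ X Z : Π x : M, TangentSpace I x, MDiffAt (T% X) x → MDiffAt (T% Z) x →
        2 * g.inner x (A (X x)) (Z x) = 2 * g.inner x (B (X x)) (Z x)) : A = B := by
    ext v
    refine g.eq_of_forall fun z => ?_
    have := h (FiberBundle.extend E v) (FiberBundle.extend E z)
      (FiberBundle.mdifferentiableAt_extend ..) (FiberBundle.mdifferentiableAt_extend ..)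
    simpa using this
  refine ⟨⟨L, ⟨fun {Y Y' x} hY hY' _ => ext' fun X Z hX hZ => ?_,
    fun {Y f x} hY hf _ => ext' fun X Z hX hZ => ?_⟩⟩, ?_, ?_⟩
  · rw [hL _ _ (mdifferentiableAt_add_section hY hY') X Z hX hZ, koszul_add₂ g hX hY hY' hZ]
    simp only [_root_.add_apply, map_add, mul_add, hL Y x hY X Z hX hZ, hL Y' x hY' X Z hX hZ]
  · rw [hL _ _ (hf.smul_section hY) X Z hX hZ, koszul_smul₂ g hX hY hf hZ]
    simp only [_root_.add_apply, map_add, mul_add, ← hL Y x hY X Z hX hZ]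
    simp
    ring
  · rw [CovariantDerivative.torsion_eq_zero_iff]
    intro X Y x hX hY
    refine g.eq_of_forall fun z => ?_
    have hZ : MDiffAt (T% (FiberBundle.extend E z)) x := FiberBundle.mdifferentiableAt_extend ..
    have h1 := hL Y x hY X _ hX hZ
    have h2 := hL X x hX Y _ hY hZ
    simp only [koszul, FiberBundle.extend_apply_self, mlieBracket_swap_apply (V := Y) (W := X),
      map_neg, _root_.neg_apply, g.symm _ (Y _) (X _)] at h1 h2
    simp only [map_sub, _root_.sub_apply]
    linarith
  · intro x X Y Z hX hY hZ
    have h1 := hL Y x hY X Z hX hZ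
    have h2 := hL Z x hZ X Y hX hY
    simp only [koszul, mlieBracket_swap_apply (V := Z) (W := Y),
      map_neg, _root_.neg_apply, g.symm _ (Z _) (Y _)] at h1 h2
    rw [g.symm x (Y x)]
    change _ = g.inner x (L Y x (X x)) (Z x) + g.inner x (L Z x (X x)) (Y x)
    linarith

/-- The Levi-Civita connection of the Riemannian metric `g`. -/
def leviCivita : CovariantDerivative I E (TangentSpace I : M → Type _) :=
  (exists_isLeviCivita g).choose

theorem isLeviCivita_leviCivita : IsLeviCivita g (leviCivita g) :=
  (exists_isLeviCivita g).choose_spec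

/-- `R_{XY} Z = ∇_X ∇_Y Z - ∇_Y ∇_X Z - ∇_{[X, Y]} Z`. -/
def curvature (X Y Z : Π x : M, TangentSpace I x) (x : M) : TangentSpace I x :=
  leviCivita g (fun y ↦ leviCivita g Z y (Y y)) x (X x)
    - leviCivita g (fun y ↦ leviCivita g Z y (X y)) x (Y x)
    - leviCivita g Z x (mlieBracket I X Y x)

/-- The Riemann-Christoffel tensor `R(X, Y, Z, W) = -g(R_{XY} Z, W)`. -/
def riemannTensor (X Y Z W : Π x : M, TangentSpace I x) (x : M) : ℝ :=
  - g.inner x (curvature g X Y Z x) (W x)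

end LeviCivita

section Structures

variable {E : Type*} [NormedAddCommGroup E] [NormedSpace ℝ E]
  {H : Type*} [TopologicalSpace H] (I : ModelWithCorners ℝ E H)
  (M : Type*) [TopologicalSpace M] [ChartedSpace H M] [IsManifold I ∞ M]

/-- An almost Hermitian structure `(J, g)` on `M`: a Riemannian metric `g` and a smooth field `J`
of endomorphisms of the tangent spaces with `J² = -1` and `g(JX, JY) = g(X, Y)`. -/
structure AlmostHermitian where
  metric : RiemannianMetricOn I M
  J : Π x : M, TangentSpace I x →L[ℝ] TangentSpace I x
  contMDiff_J : ContMDiff I (I.prod 𝓘(ℝ, E →L[ℝ] E)) ∞ (fun x ↦ Bundle.TotalSpace.mk' (E →L[ℝ] E)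
    (E := fun x : M ↦ TangentSpace I x →L[ℝ] TangentSpace I x) x (J x))
  J_J : ∀ (x : M) (v : TangentSpace I x), J x (J x v) = -v
  metric_J : ∀ (x : M) (v w : TangentSpace I x),
    metric.inner x (J x v) (J x w) = metric.inner x v w

/-- An almost contact metric structure `(φ, ξ, η, g)` on `M`: smooth tensor fields with
`φ² = -1 + η ⊗ ξ`, `η(ξ) = 1` and `g(φX, φY) = g(X, Y) - η(X) η(Y)`. -/
structure AlmostContactMetric where
  metric : RiemannianMetricOn I M
  φ : Π x : M, TangentSpace I x →L[ℝ] TangentSpace I x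
  ξ : Π x : M, TangentSpace I x
  η : Π x : M, TangentSpace I x →L[ℝ] ℝ
  contMDiff_φ : ContMDiff I (I.prod 𝓘(ℝ, E →L[ℝ] E)) ∞ (fun x ↦ Bundle.TotalSpace.mk' (E →L[ℝ] E)
    (E := fun x : M ↦ TangentSpace I x →L[ℝ] TangentSpace I x) x (φ x))
  contMDiff_ξ : ContMDiff I (I.prod 𝓘(ℝ, E)) ∞ (fun x ↦ Bundle.TotalSpace.mk' E
    (E := fun x : M ↦ TangentSpace I x) x (ξ x))
  contMDiff_η : ContMDiff I (I.prod 𝓘(ℝ, E →L[ℝ] ℝ)) ∞ (fun x ↦ Bundle.TotalSpace.mk' (E →L[ℝ] ℝ)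
    (E := fun x : M ↦ TangentSpace I x →L[ℝ] Bundle.Trivial M ℝ x) x (η x))
  φ_φ : ∀ (x : M) (v : TangentSpace I x), φ x (φ x v) = -v + η x v • ξ x
  η_ξ : ∀ x : M, η x (ξ x) = 1
  metric_φ : ∀ (x : M) (v w : TangentSpace I x),
    metric.inner x (φ x v) (φ x w) = metric.inner x v w - η x v * η x w

variable {I M} [FiniteDimensional ℝ E]

/-- `(M, J, g)` is Kähler: `∇ J = 0` for the Levi-Civita connection `∇` of `g`. -/
def AlmostHermitian.IsKaehler (A : AlmostHermitian I M) : Prop :=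
  ∀ X Y : Π x : M, TangentSpace I x, CMDiff ∞ (T% X) → CMDiff ∞ (T% Y) → ∀ x : M,
    leviCivita A.metric (fun y ↦ A.J y (Y y)) x (X x) = A.J x (leviCivita A.metric Y x (X x))

/-- The curvature identity `(G1)`: for all vector fields `X, Y, Z, W`,
`R(X, Y, φZ, φW) - R(X, Y, Z, W) = g(Y, φW) g(X, φZ) - g(X, φW) g(Y, φZ)
  + g(X, W) g(Y, Z) - g(Y, W) g(X, Z)`. -/
def AlmostContactMetric.SatisfiesG1 (S : AlmostContactMetric I M) : Prop :=
  ∀ X Y Z W : Π x : M, TangentSpace I x,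
    CMDiff ∞ (T% X) → CMDiff ∞ (T% Y) → CMDiff ∞ (T% Z) → CMDiff ∞ (T% W) → ∀ x : M,
    riemannTensor S.metric X Y (fun y ↦ S.φ y (Z y)) (fun y ↦ S.φ y (W y)) x
        - riemannTensor S.metric X Y Z W x =
      S.metric.inner x (Y x) (S.φ x (W x)) * S.metric.inner x (X x) (S.φ x (Z x))
      - S.metric.inner x (X x) (S.φ x (W x)) * S.metric.inner x (Y x) (S.φ x (Z x))
      + S.metric.inner x (X x) (W x) * S.metric.inner x (Y x) (Z x)
      - S.metric.inner x (Y x) (W x) * S.metric.inner x (X x) (Z x)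

end Structures

section WarpedProduct

variable {E : Type*} [NormedAddCommGroup E] [NormedSpace ℝ E]
  {H : Type*} [TopologicalSpace H] {I : ModelWithCorners ℝ E H}
  {N : Type*} [TopologicalSpace N] [ChartedSpace H N]
  {E' : Type*} [NormedAddCommGroup E'] [NormedSpace ℝ E']
  {H' : Type*} [TopologicalSpace H'] {I' : ModelWithCorners ℝ E' H'}
  {M : Type*} [TopologicalSpace M] [ChartedSpace H' M]  {U : TopologicalSpace.Opens ℝ}

lemma tangentCoordChange_prod [IsManifold I 1 N] [IsManifold I' 1 M] (p q r : M × N)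
    (hp : r ∈ (extChartAt (I'.prod I) p).source) (hq : r ∈ (extChartAt (I'.prod I) q).source) :
    (tangentCoordChange (I'.prod I) p q r : E' × E →L[ℝ] E' × E) =
      (tangentCoordChange I' p.1 q.1 r.1).prodMap (tangentCoordChange I p.2 q.2 r.2) := by
  have h := hasFDerivWithinAt_tangentCoordChange (I := I'.prod I) (x := p) (y := q) (z := r)
    ⟨hp, hq⟩
  rw [extChartAt_prod, PartialEquiv.prod_source] at hp hq
  have h1 := hasFDerivWithinAt_tangentCoordChange (I := I') (x := p.1) (y := q.1) (z := r.1)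
    ⟨hp.1, hq.1⟩
  have h2 := hasFDerivWithinAt_tangentCoordChange (I := I) (x := p.2) (y := q.2) (z := r.2)
    ⟨hp.2, hq.2⟩
  have hu : UniqueDiffWithinAt ℝ (Set.range I' ×ˢ Set.range I)
      ((extChartAt I' p.1 r.1), (extChartAt I p.2 r.2)) :=
    UniqueDiffWithinAt.prod (I'.uniqueDiffOn _ (by simp [extChartAt]))
      (I.uniqueDiffOn _ (by simp [extChartAt]))
  rw [modelWithCorners_prod_coe, Set.range_prodMap, extChartAt_prod, extChartAt_prod] at h
  have h3 := HasFDerivWithinAt.prodMap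
    (p := ((extChartAt I' p.1 r.1), (extChartAt I p.2 r.2)))
    (h1.mono (Set.fst_image_prod_subset (Set.range I') (Set.range I)))
    (h2.mono (Set.snd_image_prod_subset (Set.range I') (Set.range I)))
  have h4 : HasFDerivWithinAt (𝕜 := ℝ) (E := E' × E) (F := E' × E)
    (Prod.map (extChartAt I' q.1 ∘ (extChartAt I' p.1).symm)
      (extChartAt I q.2 ∘ (extChartAt I p.2).symm)) (tangentCoordChange (I'.prod I) p q r)
      (Set.range I' ×ˢ Set.range I)
      ((extChartAt I' p.1 r.1), (extChartAt I p.2 r.2)) := h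
  exact hu.eq h4 h3

lemma tangentCoordChange_opens (s t r : U) (v : ℝ) : tangentCoordChange 𝓘(ℝ, ℝ) s t r v = v := by
  have : tangentCoordChange 𝓘(ℝ, ℝ) s t r = tangentCoordChange 𝓘(ℝ, ℝ) s s r := rfl
  rw [this]
  apply tangentCoordChange_self
  rw [extChartAt_source]
  exact mem_chart_source ℝ r

lemma warped_continuousLinearMapAt [IsManifold I 1 N] (p₀ p : U × N)
    (hp : p ∈ (chartAt (ModelProd ℝ H) p₀).source) (w : ℝ × E) :
    (trivializationAt (ℝ × E) (TangentSpace (𝓘(ℝ, ℝ).prod I)) p₀).continuousLinearMapAt ℝ p w =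
      (w.1, (trivializationAt E (TangentSpace I) p₀.2).continuousLinearMapAt ℝ p.2 w.2) := by
  have hp' := hp
  rw [prodChartedSpace_chartAt, OpenPartialHomeomorph.prod_source] at hp'
  rw [TangentBundle.continuousLinearMapAt_trivializationAt_eq_core hp,
    TangentBundle.continuousLinearMapAt_trivializationAt_eq_core hp'.2]
  have := tangentCoordChange_prod (I := I) (I' := 𝓘(ℝ, ℝ)) p p₀ p
    (by simp) (by rw [extChartAt_source]; exact hp)
  refine (congr($this w)).trans ?_
  exact Prod.ext (tangentCoordChange_opens _ _ _ _) rfl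

lemma warped_symmL [IsManifold I 1 N] (p₀ p : U × N)
    (hp : p ∈ (chartAt (ModelProd ℝ H) p₀).source) (w : ℝ × E) :
    (trivializationAt (ℝ × E) (TangentSpace (𝓘(ℝ, ℝ).prod I)) p₀).symmL ℝ p w =
      ((w.1, (trivializationAt E (TangentSpace I) p₀.2).symmL ℝ p.2 w.2) : ℝ × E) := by
  have hp' := hp
  rw [prodChartedSpace_chartAt, OpenPartialHomeomorph.prod_source] at hp'
  rw [TangentBundle.symmL_trivializationAt_eq_core hp,
    TangentBundle.symmL_trivializationAt_eq_core hp'.2]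
  have := tangentCoordChange_prod (I := I) (I' := 𝓘(ℝ, ℝ)) p₀ p p
    (by rw [extChartAt_source]; exact hp) (by simp)
  refine (congr($this w)).trans ?_
  exact Prod.ext (tangentCoordChange_opens _ _ _ _) rfl

/-- The differential `dθ` of the coordinate `θ` at a point of `U × N`, where
`T_{(θ, x)} (U × N) = ℝ × T_x N`. -/
def dTheta (I : ModelWithCorners ℝ E H) (p : U × N) :
    TangentSpace (𝓘(ℝ, ℝ).prod I) p →L[ℝ] ℝ :=
  ContinuousLinearMap.fst ℝ ℝ E

/-- The differential of the projection `U × N → N`. -/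
def dProj (I : ModelWithCorners ℝ E H) (p : U × N) :
    TangentSpace (𝓘(ℝ, ℝ).prod I) p →L[ℝ] TangentSpace I p.2 :=
  ContinuousLinearMap.snd ℝ ℝ E

/-- The inclusion `T_x N → T_{(θ, x)} (U × N)`. -/
def dIncl (I : ModelWithCorners ℝ E H) (p : U × N) :
    TangentSpace I p.2 →L[ℝ] TangentSpace (𝓘(ℝ, ℝ).prod I) p :=
  ContinuousLinearMap.inr ℝ ℝ E

/-- The vector field `∂_θ` on `U × N`. -/
def partialTheta (I : ModelWithCorners ℝ E H) (p : U × N) : TangentSpace (𝓘(ℝ, ℝ).prod I) p :=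
  ((1, 0) : ℝ × E)

@[simp] lemma dTheta_dIncl (p : U × N) (v : TangentSpace I p.2) : dTheta I p (dIncl I p v) = 0 :=
  rfl

@[simp] lemma dProj_dIncl (p : U × N) (v : TangentSpace I p.2) : dProj I p (dIncl I p v) = v :=
  rfl

@[simp] lemma dTheta_partialTheta (p : U × N) : dTheta I p (partialTheta I p) = 1 := rfl

@[simp] lemma dProj_partialTheta (p : U × N) : dProj I p (partialTheta I p) = 0 := rfl

lemma tangent_ext {p : U × N} {v w : TangentSpace (𝓘(ℝ, ℝ).prod I) p}
    (h₁ : dTheta I p v = dTheta I p w) (h₂ : dProj I p v = dProj I p w) : v = w :=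
  Prod.ext h₁ h₂

lemma tangent_opens_aux (s : U) (v : ℝ) :
    mfderiv 𝓘(ℝ, ℝ) 𝓘(ℝ, ℝ) (Subtype.val : U → ℝ) s v = v := by
  have h := TangentBundle.continuousLinearMapAt_trivializationAt (I := 𝓘(ℝ, ℝ)) (x₀ := s) (x := s)
    (mem_chart_source ℝ s)
  rw [TangentBundle.continuousLinearMapAt_trivializationAt_eq_core (mem_chart_source ℝ s)] at h
  exact (congr($h v)).symm.trans (tangentCoordChange_opens s s s v)

lemma dTheta_eq_mvfderiv (p : U × N) :
    dTheta I p = mvfderiv (𝓘(ℝ, ℝ).prod I) (fun q : U × N ↦ (q.1 : ℝ)) p := by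
  have h1 : MDifferentiableAt 𝓘(ℝ, ℝ) 𝓘(ℝ, ℝ) (Subtype.val : U → ℝ) p.1 :=
    contMDiff_subtype_val.mdifferentiable one_ne_zero _
  have h2 := (h1.hasMFDerivAt.comp p (hasMFDerivAt_fst (I := 𝓘(ℝ, ℝ)) (I' := I) (x := p))).mfderiv
  refine ContinuousLinearMap.ext fun v ↦ ?_
  exact (tangent_opens_aux p.1 (dTheta I p v)).symm.trans congr($h2 v).symm

lemma dProj_eq_mfderiv (p : U × N) :
    dProj I p = mfderiv (𝓘(ℝ, ℝ).prod I) I (Prod.snd : U × N → N) p :=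
  mfderiv_snd.symm

lemma dIncl_eq_mfderiv (p : U × N) :
    dIncl I p = mfderiv I (𝓘(ℝ, ℝ).prod I) (fun x : N ↦ (p.1, x)) p.2 :=
  mfderiv_prod_right.symm

variable [IsManifold I ∞ N]

/-- The bilinear form `g = dθ² + f(θ)² ḡ` on `T_{(θ, x)} (U × N) = ℝ × T_x N`. -/
def warpedInner (g : RiemannianMetricOn I N) (f : ℝ → ℝ) (p : U × N) :
    TangentSpace (𝓘(ℝ, ℝ).prod I) p →L[ℝ] TangentSpace (𝓘(ℝ, ℝ).prod I) p →L[ℝ] ℝ :=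
  let g' : E →L[ℝ] E →L[ℝ] ℝ := g.inner p.2
  ((ContinuousLinearMap.mul ℝ ℝ).bilinearComp
      (ContinuousLinearMap.fst ℝ ℝ E) (ContinuousLinearMap.fst ℝ ℝ E)
    + f p.1 ^ 2 • g'.bilinearComp (ContinuousLinearMap.snd ℝ ℝ E) (ContinuousLinearMap.snd ℝ ℝ E) :
    ℝ × E →L[ℝ] ℝ × E →L[ℝ] ℝ)

lemma warpedInner_apply (g : RiemannianMetricOn I N) (f : ℝ → ℝ) (p : U × N)
    (v w : TangentSpace (𝓘(ℝ, ℝ).prod I) p) :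
    warpedInner g f p v w =
      dTheta I p v * dTheta I p w + f p.1 ^ 2 * g.inner p.2 (dProj I p v) (dProj I p w) := rfl

lemma contMDiffAt_bilinearComp {E'' : Type*} [NormedAddCommGroup E''] [NormedSpace ℝ E'']
    {H'' : Type*} [TopologicalSpace H''] {I'' : ModelWithCorners ℝ E'' H''}
    {M : Type*} [TopologicalSpace M] [ChartedSpace H'' M] (L : E' →L[ℝ] E) {u : M → E →L[ℝ] E →L[ℝ] ℝ} {x : M}
    (hu : ContMDiffAt I'' 𝓘(ℝ, E →L[ℝ] E →L[ℝ] ℝ) ∞ u x) :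
    ContMDiffAt I'' 𝓘(ℝ, E' →L[ℝ] E' →L[ℝ] ℝ) ∞ (fun y ↦ (u y).bilinearComp L L) x := by
  have h : ContDiff ℝ ∞ (fun B : E →L[ℝ] E →L[ℝ] ℝ ↦ B.bilinearComp L L) :=
    ContinuousLinearMap.contDiff (𝕜 := ℝ) (E := E →L[ℝ] E →L[ℝ] ℝ) (F := E' →L[ℝ] E' →L[ℝ] ℝ)
      ((ContinuousLinearMap.compL ℝ E' E (E' →L[ℝ] ℝ)).flip L ∘L
        ContinuousLinearMap.compL ℝ E (E →L[ℝ] ℝ) (E' →L[ℝ] ℝ)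
          ((ContinuousLinearMap.compL ℝ E' E ℝ).flip L))
  exact h.comp_contMDiffAt hu

lemma trivializationAt_bilin [IsManifold I' 1 M] {x₀ x : M} (hx : x ∈ (chartAt H' x₀).source)
    (B : TangentSpace I' x →L[ℝ] TangentSpace I' x →L[ℝ] ℝ) (v w : E') :
    (trivializationAt (E' →L[ℝ] E' →L[ℝ] ℝ)
      (fun x : M ↦ TangentSpace I' x →L[ℝ] TangentSpace I' x →L[ℝ] ℝ) x₀
      (Bundle.TotalSpace.mk' (E' →L[ℝ] E' →L[ℝ] ℝ) x B)).2 v w =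
    B ((trivializationAt E' (TangentSpace I') x₀).symmL ℝ x v)
      ((trivializationAt E' (TangentSpace I') x₀).symmL ℝ x w) := by
  have hx' : x ∈ (trivializationAt E' (TangentSpace I' : M → Type _) x₀).baseSet := hx
  refine (inCoordinates_apply_eq₂ (E₃ := Bundle.Trivial M ℝ) hx' hx' (Set.mem_univ x)).trans ?_
  rw [← Bundle.Trivialization.symmL_apply (R := ℝ) _ hx', ← Bundle.Trivialization.symmL_apply (R := ℝ) _ hx']
  simp

lemma eventually_mem_chartAt_source (p₀ : M) : ∀ᶠ p in 𝓝 p₀, p ∈ (chartAt H' p₀).source :=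
  (chartAt H' p₀).open_source.mem_nhds (mem_chart_source H' p₀)

lemma contMDiff_warpedInner (g : RiemannianMetricOn I N) {f : ℝ → ℝ} (hf : ContDiffOn ℝ ∞ f U) :
    ContMDiff (𝓘(ℝ, ℝ).prod I) ((𝓘(ℝ, ℝ).prod I).prod 𝓘(ℝ, ℝ × E →L[ℝ] ℝ × E →L[ℝ] ℝ)) ∞
      (fun p : U × N ↦ Bundle.TotalSpace.mk' (ℝ × E →L[ℝ] ℝ × E →L[ℝ] ℝ)
        (E := fun p : U × N ↦ TangentSpace (𝓘(ℝ, ℝ).prod I) p →L[ℝ]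
          TangentSpace (𝓘(ℝ, ℝ).prod I) p →L[ℝ] ℝ) p (warpedInner g f p)) := by
  intro p₀
  rw [Bundle.contMDiffAt_section]
  have hg := (Bundle.contMDiffAt_section (x₀ := p₀.2)).1 (g.contMDiff p₀.2)
  let G : N → E →L[ℝ] E →L[ℝ] ℝ := fun x ↦
    (trivializationAt (E →L[ℝ] E →L[ℝ] ℝ)
      (fun x : N ↦ TangentSpace I x →L[ℝ] TangentSpace I x →L[ℝ] ℝ) p₀.2
      (Bundle.TotalSpace.mk' (E →L[ℝ] E →L[ℝ] ℝ) x (g.inner x))).2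
  have hG : ContMDiffAt I 𝓘(ℝ, E →L[ℝ] E →L[ℝ] ℝ) ∞ G p₀.2 := hg
  have hG' : ContMDiffAt (𝓘(ℝ, ℝ).prod I) 𝓘(ℝ, E →L[ℝ] E →L[ℝ] ℝ) ∞
      (fun p : U × N ↦ G p.2) p₀ := ContMDiffAt.comp (g := G) (f := Prod.snd) (I' := I) p₀ hG contMDiffAt_snd
  have hf' : ContMDiffAt (𝓘(ℝ, ℝ).prod I) 𝓘(ℝ, ℝ) ∞ (fun p : U × N ↦ f p.1) p₀ :=
    ContMDiffAt.comp (I' := 𝓘(ℝ, ℝ)) p₀ (hf.contDiffAt (U.isOpen.mem_nhds p₀.1.2)).contMDiffAt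
      (contMDiff_subtype_val.contMDiffAt.comp p₀ contMDiffAt_fst)
  have key : ContMDiffAt (𝓘(ℝ, ℝ).prod I) 𝓘(ℝ, ℝ × E →L[ℝ] ℝ × E →L[ℝ] ℝ) ∞
    (fun p : U × N ↦ (ContinuousLinearMap.mul ℝ ℝ).bilinearComp
      (ContinuousLinearMap.fst ℝ ℝ E) (ContinuousLinearMap.fst ℝ ℝ E) +
      f p.1 ^ 2 • (G p.2).bilinearComp (ContinuousLinearMap.snd ℝ ℝ E) (ContinuousLinearMap.snd ℝ ℝ E)) p₀ := by
    have := contMDiffAt_bilinearComp (ContinuousLinearMap.snd ℝ ℝ E) hG'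
    exact contMDiffAt_const.add ((hf'.pow 2).smul this)
  refine key.congr_of_eventuallyEq ?_
  filter_upwards [eventually_mem_chartAt_source (H' := ModelProd ℝ H) p₀] with p hp
  have hp' := hp
  rw [prodChartedSpace_chartAt, OpenPartialHomeomorph.prod_source] at hp'
  refine ContinuousLinearMap.ext fun v ↦ ContinuousLinearMap.ext fun w ↦ ?_
  refine (trivializationAt_bilin hp _ v w).trans ?_
  have h2 : G p.2 v.2 w.2 = _ := trivializationAt_bilin hp'.2 (g.inner p.2) v.2 w.2
  change _ = v.1 * w.1 + f p.1 ^ 2 • (G p.2 v.2 w.2)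
  rw [h2, warped_symmL p₀ p hp v, warped_symmL p₀ p hp w]
  rfl

lemma RiemannianMetricOn.inner_self_nonneg (g : RiemannianMetricOn I N) {x : N} (v : TangentSpace I x) :
    0 ≤ g.inner x v v := by
  by_cases h0 : v = 0
  · simp [h0]
  · exact (g.pos x v h0).le

lemma isVonNBounded_warpedInner (g : RiemannianMetricOn I N) (f : ℝ → ℝ) (p : U × N)
    (hf : 0 < f p.1) :
    Bornology.IsVonNBounded ℝ {v : TangentSpace (𝓘(ℝ, ℝ).prod I) p | warpedInner g f p v v < 1} := by
  have h : Bornology.IsVonNBounded ℝ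
      ((fun v : E ↦ (f p.1)⁻¹ • v) '' {v : E | g.inner p.2 v v < 1}) :=
    (g.isVonNBounded p.2).image ((f p.1)⁻¹ • ContinuousLinearMap.id ℝ (TangentSpace I p.2))
  have h1 := (Metric.isBounded_closedBall (x := (0 : ℝ)) (r := 1)).prod
    ((NormedSpace.isVonNBounded_iff ℝ).1 h)
  refine (NormedSpace.isVonNBounded_iff (E := ℝ × E) ℝ).2 (h1.subset fun v hv ↦ ?_)
  have hv' : dTheta I p v * dTheta I p v
      + f p.1 ^ 2 * g.inner p.2 (dProj I p v) (dProj I p v) < 1 := hv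
  have hs : 0 ≤ f p.1 ^ 2 * g.inner p.2 (dProj I p v) (dProj I p v) :=
    mul_nonneg (sq_nonneg _) (g.inner_self_nonneg _)
  refine ⟨?_, f p.1 • v.2, ?_, ?_⟩
  · rw [mem_closedBall_zero_iff, Real.norm_eq_abs, ← sq_le_one_iff_abs_le_one]
    change dTheta I p v ^ 2 ≤ 1
    nlinarith
  · change g.inner p.2 (f p.1 • dProj I p v) (f p.1 • dProj I p v) < 1
    simp only [map_smul, _root_.smul_apply, smul_eq_mul]
    nlinarith [mul_self_nonneg (dTheta I p v)]
  · simp [smul_smul, hf.ne']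

/-- The warped product metric `g = dθ² + f(θ)² ḡ` on `U ×_f N`. -/
def warpedMetric (g : RiemannianMetricOn I N) (f : ℝ → ℝ) (hf : ContDiffOn ℝ ∞ f U)
    (hpos : ∀ t ∈ U, 0 < f t) : RiemannianMetricOn (𝓘(ℝ, ℝ).prod I) (U × N) where
  inner := warpedInner g f
  symm p v w := by
    rw [warpedInner_apply, warpedInner_apply, g.symm, mul_comm (dTheta I p v)]
  pos p v hv := by
    rw [warpedInner_apply]
    have hf0 : 0 < f p.1 := hpos _ p.1.2
    by_cases h0 : dProj I p v = 0
    · have h1 : dTheta I p v ≠ 0 := fun h1 ↦ hv (Prod.ext h1 h0)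
      have := mul_self_pos.2 h1
      simpa [h0] using this
    · have := mul_pos (pow_pos hf0 2) (g.pos p.2 _ h0)
      nlinarith [mul_self_nonneg (dTheta I p v)]
  isVonNBounded p := isVonNBounded_warpedInner g f p (hpos _ p.1.2)
  contMDiff := contMDiff_warpedInner g hf

/-- The endomorphism field `φ` on `U × N` with `φ ∂_θ = 0` and `φ X = J X` for `X` tangent
to `N`. -/
def warpedPhi (J : Π x : N, TangentSpace I x →L[ℝ] TangentSpace I x) (p : U × N) :
    TangentSpace (𝓘(ℝ, ℝ).prod I) p →L[ℝ] TangentSpace (𝓘(ℝ, ℝ).prod I) p :=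
  dIncl I p ∘L J p.2 ∘L dProj I p

lemma contMDiff_warpedPhi (A : AlmostHermitian I N) :
    ContMDiff (𝓘(ℝ, ℝ).prod I) ((𝓘(ℝ, ℝ).prod I).prod 𝓘(ℝ, ℝ × E →L[ℝ] ℝ × E)) ∞
      (fun p : U × N ↦ Bundle.TotalSpace.mk' (ℝ × E →L[ℝ] ℝ × E)
        (E := fun p : U × N ↦ TangentSpace (𝓘(ℝ, ℝ).prod I) p →L[ℝ]
          TangentSpace (𝓘(ℝ, ℝ).prod I) p) p (warpedPhi A.J p)) := by
  intro p₀
  rw [Bundle.contMDiffAt_section]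
  have hJ := (Bundle.contMDiffAt_section (x₀ := p₀.2)).1 (A.contMDiff_J p₀.2)
  let G : N → E →L[ℝ] E := fun x ↦
    (trivializationAt (E →L[ℝ] E) (fun x : N ↦ TangentSpace I x →L[ℝ] TangentSpace I x) p₀.2
      (Bundle.TotalSpace.mk' (E →L[ℝ] E) x (A.J x))).2
  have hG : ContMDiffAt I 𝓘(ℝ, E →L[ℝ] E) ∞ G p₀.2 := hJ
  have hG' : ContMDiffAt (𝓘(ℝ, ℝ).prod I) 𝓘(ℝ, E →L[ℝ] E) ∞
      (fun p : U × N ↦ G p.2) p₀ :=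
    ContMDiffAt.comp (g := G) (f := Prod.snd) (I' := I) p₀ hG contMDiffAt_snd
  have key : ContMDiffAt (𝓘(ℝ, ℝ).prod I) 𝓘(ℝ, ℝ × E →L[ℝ] ℝ × E) ∞
      (fun p : U × N ↦ (0 : ℝ →L[ℝ] ℝ).prodMap (G p.2)) p₀ := contMDiffAt_const.clm_prodMap hG'
  refine key.congr_of_eventuallyEq ?_
  filter_upwards [eventually_mem_chartAt_source (H' := ModelProd ℝ H) p₀] with p hp
  have hp' := hp
  rw [prodChartedSpace_chartAt, OpenPartialHomeomorph.prod_source] at hp'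
  refine ContinuousLinearMap.ext fun v ↦ ?_
  have h1 : G p.2 v.2 = (trivializationAt E (TangentSpace I) p₀.2).continuousLinearMapAt ℝ p.2
    (A.J p.2 ((trivializationAt E (TangentSpace I) p₀.2).symmL ℝ p.2 v.2)) := rfl
  change (trivializationAt (ℝ × E) (TangentSpace (𝓘(ℝ, ℝ).prod I)) p₀).continuousLinearMapAt ℝ p
    (warpedPhi A.J p ((trivializationAt (ℝ × E) (TangentSpace (𝓘(ℝ, ℝ).prod I)) p₀).symmL ℝ p v))
      = (0, G p.2 v.2)
  rw [h1, warped_symmL p₀ p hp v]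
  exact warped_continuousLinearMapAt p₀ p hp _

lemma contMDiff_partialTheta :
    ContMDiff (𝓘(ℝ, ℝ).prod I) ((𝓘(ℝ, ℝ).prod I).prod 𝓘(ℝ, ℝ × E)) ∞
      (fun p : U × N ↦ Bundle.TotalSpace.mk' (ℝ × E)
        (E := fun p : U × N ↦ TangentSpace (𝓘(ℝ, ℝ).prod I) p) p (partialTheta I p)) := by
  intro p₀
  rw [Bundle.contMDiffAt_section]
  refine (contMDiffAt_const (c := ((1, 0) : ℝ × E))).congr_of_eventuallyEq ?_
  filter_upwards [eventually_mem_chartAt_source (H' := ModelProd ℝ H) p₀] with p hp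
  have h := warped_continuousLinearMapAt (I := I) p₀ p hp ((1, 0) : ℝ × E)
  refine Eq.trans ?_ (h.trans (Prod.ext rfl (map_zero _)))
  symm
  apply Bundle.Trivialization.continuousLinearMapAt_apply_of_mem
  exact hp

lemma contMDiff_dTheta :
    ContMDiff (𝓘(ℝ, ℝ).prod I) ((𝓘(ℝ, ℝ).prod I).prod 𝓘(ℝ, ℝ × E →L[ℝ] ℝ)) ∞
      (fun p : U × N ↦ Bundle.TotalSpace.mk' (ℝ × E →L[ℝ] ℝ)
        (E := fun p : U × N ↦ TangentSpace (𝓘(ℝ, ℝ).prod I) p →L[ℝ] Bundle.Trivial (U × N) ℝ p)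
          p (dTheta I p)) := by
  intro p₀
  rw [Bundle.contMDiffAt_section]
  refine (contMDiffAt_const (c := ContinuousLinearMap.fst ℝ ℝ E)).congr_of_eventuallyEq ?_
  filter_upwards [eventually_mem_chartAt_source (H' := ModelProd ℝ H) p₀] with p hp
  refine ContinuousLinearMap.ext fun v ↦ ?_
  change (trivializationAt ℝ (Bundle.Trivial (U × N) ℝ) p₀).continuousLinearMapAt ℝ p
    (dTheta I p
      ((trivializationAt (ℝ × E) (TangentSpace (𝓘(ℝ, ℝ).prod I)) p₀).symmL ℝ p v)) = v.1
  rw [warped_symmL p₀ p hp v]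
  simp
  rfl

/-- The almost contact metric structure on the warped product `M = U ×_f N` of an open set
`U ⊆ ℝ` with coordinate `θ` and an almost Hermitian manifold `(N, ḡ, J)`:
`g = dθ² + f(θ)² ḡ`, `ξ = ∂_θ`, `η = dθ`, `φ ∂_θ = 0` and `φ X = J X` for `X` tangent to `N`. -/
def AlmostHermitian.warpedProduct (A : AlmostHermitian I N) (U : TopologicalSpace.Opens ℝ)
    (f : ℝ → ℝ) (hf : ContDiffOn ℝ ∞ f U) (hpos : ∀ t ∈ U, 0 < f t) :
    AlmostContactMetric (𝓘(ℝ, ℝ).prod I) (U × N) where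
  metric := warpedMetric A.metric f hf hpos
  φ := warpedPhi A.J
  ξ := partialTheta I
  η := dTheta I
  contMDiff_φ := contMDiff_warpedPhi A
  contMDiff_ξ := contMDiff_partialTheta
  contMDiff_η := contMDiff_dTheta
  φ_φ p v := by
    apply tangent_ext <;> simp [warpedPhi, A.J_J]
  η_ξ _ := rfl
  metric_φ p v w := by
    change warpedInner A.metric f p _ _ = warpedInner A.metric f p _ _ - _
    simp only [warpedInner_apply]
    simp [warpedPhi, A.metric_J]

end WarpedProduct

end

section LeviCivitaConnection

variable {E : Type*} [NormedAddCommGroup E] [NormedSpace ℝ E] [FiniteDimensional ℝ E]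
  {H : Type*} [TopologicalSpace H] {I : ModelWithCorners ℝ E H}
  {M : Type*} [TopologicalSpace M] [ChartedSpace H M] [IsManifold I ∞ M]
  (g : RiemannianMetricOn I M) {X Y Z W : Π x : M, TangentSpace I x} {x : M}

lemma mvfderiv_inner_eq (hX : MDiffAt (T% X) x) (hY : MDiffAt (T% Y) x)
    (hZ : MDiffAt (T% Z) x) :
    d% (fun y => g.inner y (Y y) (Z y)) x (X x) =
      g.inner x (leviCivita g Y x (X x)) (Z x) + g.inner x (Y x) (leviCivita g Z x (X x)) :=
  (isLeviCivita_leviCivita g).2 hX hY hZ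

lemma leviCivita_sub_swap (hX : MDiffAt (T% X) x) (hY : MDiffAt (T% Y) x) :
    leviCivita g Y x (X x) - leviCivita g X x (Y x) = mlieBracket I X Y x :=
  ((leviCivita g).torsion_eq_zero_iff).1 (isLeviCivita_leviCivita g).1 hX hY

lemma two_mul_inner_leviCivita (hX : MDiffAt (T% X) x) (hY : MDiffAt (T% Y) x)
    (hZ : MDiffAt (T% Z) x) :
    2 * g.inner x (leviCivita g Y x (X x)) (Z x) = koszul g X Y Z x := by
  rw [koszul, mvfderiv_inner_eq g hX hY hZ, mvfderiv_inner_eq g hY hX hZ,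
    mvfderiv_inner_eq g hZ hX hY, ← leviCivita_sub_swap g hX hY, ← leviCivita_sub_swap g hX hZ,
    ← leviCivita_sub_swap g hY hZ]
  simp only [map_sub, _root_.sub_apply]
  rw [g.symm x (Y x), g.symm x (X x) (leviCivita g Z x (Y x)),
    g.symm x (X x) (leviCivita g Y x (Z x))]
  ring

omit [FiniteDimensional ℝ E] in
lemma RiemannianMetricOn.contMDiffAt_inner (hX : CMDiffAt ∞ (T% X) x)
    (hY : CMDiffAt ∞ (T% Y) x) : CMDiffAt ∞ (fun y => g.inner y (X y) (Y y)) x := by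
  have : ContMDiffAt I (I.prod 𝓘(ℝ, ℝ)) ∞
      (fun m ↦ Bundle.TotalSpace.mk' ℝ (E := Bundle.Trivial M ℝ) m (g.inner m (X m) (Y m))) x := by
    apply ContMDiffAt.clm_bundle_apply₂ (F₁ := E) (F₂ := E)
    · exact g.contMDiff x
    · exact hX
    · exact hY
  simp only [Bundle.contMDiffAt_totalSpace] at this
  exact this.2

omit [FiniteDimensional ℝ E] in
lemma ContMDiffAt.mvfderiv_apply {u : M → ℝ} (hu : CMDiffAt ∞ u x)
    (hX : CMDiffAt ∞ (T% X) x) : CMDiffAt ∞ (fun y => d% u y (X y)) x := by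
  have h1 := hu.mfderiv_const (m := ∞) (n := ∞) (by simp)
  have h2 := ContMDiffAt.clm_apply_of_inCoordinates
    (F₁ := E) (F₂ := ℝ) (E₁ := TangentSpace I) (E₂ := TangentSpace 𝓘(ℝ, ℝ))
    (b₁ := id) (b₂ := u) (v := X) (ϕ := fun y => mfderiv I 𝓘(ℝ, ℝ) u y) (m₀ := x) h1 hX hu
  exact (contMDiff_snd_tangentBundle_modelSpace ℝ 𝓘(ℝ, ℝ)).contMDiffAt.comp x h2

omit [FiniteDimensional ℝ E] in
lemma ContMDiffAt.eventually_mdifferentiableAt_section (hX : CMDiffAt ∞ (T% X) x) :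
    ∀ᶠ y in 𝓝 x, MDiffAt (T% X) y := by
  have h1 : CMDiffAt 1 (T% X) x := hX.of_le (by simp)
  have : IsManifold I 1 M := IsManifold.of_le (n := ∞) (by simp)
  filter_upwards [(contMDiffAt_iff_contMDiffAt_nhds (by simp)).1 h1] with y hy
  exact hy.mdifferentiableAt one_ne_zero

omit [FiniteDimensional ℝ E] in
lemma ContMDiffAt.eventually_mdifferentiableAt {u : M → ℝ} (hu : CMDiffAt ∞ u x) :
    ∀ᶠ y in 𝓝 x, MDiffAt u y := by
  have h1 : CMDiffAt 1 u x := hu.of_le (by simp)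
  have : IsManifold I 1 M := IsManifold.of_le (n := ∞) (by simp)
  filter_upwards [(contMDiffAt_iff_contMDiffAt_nhds (by simp)).1 h1] with y hy
  exact hy.mdifferentiableAt one_ne_zero

lemma two_le_infty : (2 : ℕ∞ω) ≤ ∞ := ENat.LEInfty.out

lemma three_le_infty : (3 : ℕ∞ω) ≤ ∞ := WithTop.coe_le_coe.2 (le_top : (3 : ℕ∞) ≤ ⊤)

lemma contMDiffAt_mlieBracket (hX : CMDiffAt ∞ (T% X) x) (hY : CMDiffAt ∞ (T% Y) x) :
    CMDiffAt ∞ (T% (mlieBracket I X Y)) x := by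
  have : IsManifold I ((⊤ : ℕ∞) + 1) M := by simpa using ‹IsManifold I ∞ M›
  have : IsManifold I (minSmoothness ℝ 2) M :=
    IsManifold.of_le (n := ∞) (by simpa using two_le_infty)
  exact ContMDiffAt.mlieBracket_vectorField (n := ⊤) (m := ⊤) hX hY (by simp)

lemma mlieBracket_mlieBracket_smul {u : M → ℝ} (hu : CMDiffAt ∞ u x)
    (hY : CMDiffAt ∞ (T% Y) x) (hZ : CMDiffAt ∞ (T% Z) x) :
    mlieBracket I X (mlieBracket I Y (u • Z)) x =
      d% (fun y => d% u y (Y y)) x (X x) • Z x + d% u x (Y x) • mlieBracket I X Z x +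
        d% u x (X x) • mlieBracket I Y Z x + u x • mlieBracket I X (mlieBracket I Y Z) x := by
  have huY : MDiffAt (fun y => d% u y (Y y)) x :=
    (hu.mvfderiv_apply hY).mdifferentiableAt (by simp)
  have hYZ : MDiffAt (T% (mlieBracket I Y Z)) x :=
    (contMDiffAt_mlieBracket hY hZ).mdifferentiableAt (by simp)
  have hZ' : MDiffAt (T% Z) x := hZ.mdifferentiableAt (by simp)
  have hu' : MDiffAt u x := hu.mdifferentiableAt (by simp)
  have h : mlieBracket I Y (u • Z) =ᶠ[𝓝 x]
      (fun y => d% u y (Y y)) • Z + u • mlieBracket I Y Z := by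
    filter_upwards [hu.eventually_mdifferentiableAt, hZ.eventually_mdifferentiableAt_section]
      with y huy hZy
    exact mlieBracket_smul_right huy hZy
  rw [Filter.EventuallyEq.mlieBracket_vectorField_eq (V := X) Filter.EventuallyEq.rfl h,
    mlieBracket_add_right (huY.smul_section hZ') (hu'.smul_section hYZ),
    mlieBracket_smul_right huY hZ', mlieBracket_smul_right hu' hYZ]
  abel

/-- The Lie bracket acts on functions as the commutator. -/
lemma mvfderiv_mlieBracket {u : M → ℝ} (hu : CMDiffAt ∞ u x)
    (hX : CMDiffAt ∞ (T% X) x) (hY : CMDiffAt ∞ (T% Y) x) :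
    d% u x (mlieBracket I X Y x) =
      d% (fun y => d% u y (Y y)) x (X x) - d% (fun y => d% u y (X y)) x (Y x) := by
  have key (v : TangentSpace I x) : d% u x (mlieBracket I X Y x) • v =
      (d% (fun y => d% u y (Y y)) x (X x) - d% (fun y => d% u y (X y)) x (Y x)) • v := by
    have : IsManifold I (minSmoothness ℝ 3) M :=
      IsManifold.of_le (n := ∞) (by simpa using three_le_infty)
    have h2 : minSmoothness ℝ 2 ≤ (∞ : ℕ∞ω) := by simpa using two_le_infty
    let Z : Π y : M, TangentSpace I y := FiberBundle.extend E v
    have hZ : CMDiffAt ∞ (T% Z) x := FiberBundle.contMDiffAt_extend ..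
    have huZ : CMDiffAt ∞ (T% (u • Z)) x := hu.smul_section hZ
    have h := leibniz_identity_mlieBracket_apply (hX.of_le h2) (hY.of_le h2) (huZ.of_le h2)
    have h' := leibniz_identity_mlieBracket_apply (hX.of_le h2) (hY.of_le h2) (hZ.of_le h2)
    rw [mlieBracket_mlieBracket_smul hu hY hZ, mlieBracket_mlieBracket_smul hu hX hZ,
      mlieBracket_smul_right (hu.mdifferentiableAt (by simp)) (hZ.mdifferentiableAt (by simp)),
      h', show Z x = v from FiberBundle.extend_apply_self E v] at h
    rw [← sub_eq_zero, ← sub_eq_zero.2 h.symm]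
    module
  by_cases hE : ∃ v : TangentSpace I x, v ≠ 0
  · obtain ⟨v, hv⟩ := hE
    exact smul_left_injective ℝ hv (key v)
  · push Not at hE
    simp [hE (mlieBracket I X Y x), hE (X x), hE (Y x)]

/-- A vector field is differentiable when its inner products with coordinate fields are. -/
lemma RiemannianMetricOn.mdifferentiableAt_of_inner {A : Π x : M, TangentSpace I x}
    (h : ∀ v : TangentSpace I x,
      MDiffAt (fun y => g.inner y (A y) ((FiberBundle.extend E v : Π y : M, TangentSpace I y) y)) x) :
    MDiffAt (T% A) x := by
  classical
  let t := trivializationAt E (TangentSpace I : M → Type _) x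
  let G : M → E →L[ℝ] E →L[ℝ] ℝ := fun y ↦
    (trivializationAt (E →L[ℝ] E →L[ℝ] ℝ)
      (fun x : M ↦ TangentSpace I x →L[ℝ] TangentSpace I x →L[ℝ] ℝ) x
      (Bundle.TotalSpace.mk' (E →L[ℝ] E →L[ℝ] ℝ) y (g.inner y))).2
  have hG : ContMDiffAt I 𝓘(ℝ, E →L[ℝ] E →L[ℝ] ℝ) ∞ G x :=
    (Bundle.contMDiffAt_section (x₀ := x)).1 (g.contMDiff x)
  have hGy : ∀ y ∈ (chartAt H x).source, ∀ v w, G y v w =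
      g.inner y (t.symmL ℝ y v) (t.symmL ℝ y w) := fun y hy v w =>
    trivializationAt_bilin hy _ v w
  have hcoord : ∀ y ∈ (chartAt H x).source, t.symmL ℝ y (t ⟨y, A y⟩).2 = A y := fun y hy => by
    rw [Bundle.Trivialization.symmL_apply (R := ℝ) t (show y ∈ t.baseSet from hy)]
    exact t.symm_apply_apply_mk (show y ∈ t.baseSet from hy) _
  have hk : MDiffAt (fun y => G y (t ⟨y, A y⟩).2) x := by
    let b := Module.finBasis ℝ E
    have h1 : ∀ i, MDiffAt (fun y => g.inner y (A y) (t.symmL ℝ y (b i))) x := fun i => by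
      refine (h (t.symmL ℝ x (b i))).congr_of_eventuallyEq ?_
      filter_upwards [eventually_mem_chartAt_source (H' := H) x] with y hy
      have hx : x ∈ t.baseSet := FiberBundle.mem_baseSet_trivializationAt' x
      congr 1
      rw [Bundle.Trivialization.symmL_apply (R := ℝ) t (show y ∈ t.baseSet from hy),
        Bundle.Trivialization.symmL_apply (R := ℝ) t hx, FiberBundle.extend]
      change _ = t.symm y (t ⟨x, t.symm x (b i)⟩).2
      rw [t.apply_mk_symm hx]
    have h2 : MDiffAt (∑ i, fun y => (g.inner y (A y) (t.symmL ℝ y (b i))) •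
        LinearMap.toContinuousLinearMap (b.coord i)) x :=
      MDifferentiableAt.sum fun i _ => (h1 i).smul mdifferentiableAt_const
    refine h2.congr_of_eventuallyEq ?_
    filter_upwards [eventually_mem_chartAt_source (H' := H) x] with y hy
    refine ContinuousLinearMap.coe_injective (b.ext fun j => ?_)
    simp [hGy y hy, hcoord y hy, Finsupp.single_apply]
  have hinv : ∀ y ∈ (chartAt H x).source, (G y).IsInvertible := fun y hy => by
    let B : E →ₗ[ℝ] Module.Dual ℝ E := ContinuousLinearMap.coeLM ℝ ∘ₗ (G y).toLinearMap
    have hB : Function.Injective B := by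
      refine (injective_iff_map_eq_zero B).2 fun v hv => ?_
      have h0 : G y v v = 0 := congr($hv v)
      rw [hGy y hy] at h0
      by_contra hne
      refine (g.pos y (t.symmL ℝ y v) fun h1 => hne ?_).ne' h0
      rw [← t.continuousLinearMapAt_symmL (R := ℝ) (show y ∈ t.baseSet from hy) v, h1, map_zero]
    let S := LinearEquiv.ofInjectiveOfFinrankEq B hB (Subspace.dual_finrank_eq).symm
    exact ⟨(S.trans LinearMap.toContinuousLinearMap).toContinuousLinearEquiv,
      ContinuousLinearMap.ext fun v => ContinuousLinearMap.ext fun w => rfl⟩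
  have hG' : MDiffAt (fun y => (G y).inverse) x :=
    ((hinv x (mem_chart_source H x)).contDiffAt_map_inverse (n := 1)).contMDiffAt.mdifferentiableAt (by simp) |>.comp x
      (hG.mdifferentiableAt (by simp))
  rw [t.mdifferentiableAt_section_iff I A (FiberBundle.mem_baseSet_trivializationAt' x)]
  refine (hG'.clm_apply hk).congr_of_eventuallyEq ?_
  filter_upwards [eventually_mem_chartAt_source (H' := H) x] with y hy
  exact ((hinv y hy).inverse_apply_eq.2 rfl).symm

end LeviCivitaConnection

section Curvature

variable {E : Type*} [NormedAddCommGroup E] [NormedSpace ℝ E] [FiniteDimensional ℝ E]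
  {H : Type*} [TopologicalSpace H] {I : ModelWithCorners ℝ E H}
  {M : Type*} [TopologicalSpace M] [ChartedSpace H M] [IsManifold I ∞ M]
  (g : RiemannianMetricOn I M) {X Y Z W : Π x : M, TangentSpace I x} {x : M}

lemma contMDiffAt_koszul (hX : CMDiffAt ∞ (T% X) x) (hY : CMDiffAt ∞ (T% Y) x)
    (hZ : CMDiffAt ∞ (T% Z) x) : CMDiffAt ∞ (koszul g X Y Z) x :=
  (((((g.contMDiffAt_inner hY hZ).mvfderiv_apply hX).add
    ((g.contMDiffAt_inner hX hZ).mvfderiv_apply hY)).sub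
    ((g.contMDiffAt_inner hX hY).mvfderiv_apply hZ)).add
    (g.contMDiffAt_inner (contMDiffAt_mlieBracket hX hY) hZ)).sub
    (g.contMDiffAt_inner (contMDiffAt_mlieBracket hX hZ) hY) |>.sub
    (g.contMDiffAt_inner (contMDiffAt_mlieBracket hY hZ) hX)

lemma mdifferentiableAt_leviCivita (hX : CMDiffAt ∞ (T% X) x) (hY : CMDiffAt ∞ (T% Y) x) :
    MDiffAt (T% (fun y => leviCivita g Y y (X y))) x := by
  refine g.mdifferentiableAt_of_inner fun v => ?_
  have hZ : CMDiffAt ∞ (T% (FiberBundle.extend E v : Π y : M, TangentSpace I y)) x :=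
    FiberBundle.contMDiffAt_extend ..
  have h : MDiffAt (fun y => (1 / 2 : ℝ) • koszul g X Y (FiberBundle.extend E v) y) x :=
    ((contMDiffAt_koszul g hX hY hZ).mdifferentiableAt (by simp)).const_smul _
  refine h.congr_of_eventuallyEq ?_
  filter_upwards [hX.eventually_mdifferentiableAt_section,
    hY.eventually_mdifferentiableAt_section, hZ.eventually_mdifferentiableAt_section]
    with y hXy hYy hZy
  rw [← two_mul_inner_leviCivita g hXy hYy hZy]
  simp

omit [FiniteDimensional ℝ E] [IsManifold I ∞ M] in
lemma Filter.EventuallyEq.mvfderiv_eq {u v : M → ℝ} (h : u =ᶠ[𝓝 x] v) :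
    mvfderiv I u x = mvfderiv I v x :=
  ContinuousLinearMap.ext fun w => congr($(h.mfderiv_eq (I := I) (I' := 𝓘(ℝ, ℝ))) w)

/-- The second derivative of `g(Z, W)` in terms of the Levi-Civita connection. -/
lemma mvfderiv_mvfderiv_inner (hX : CMDiffAt ∞ (T% X) x) (hY : CMDiffAt ∞ (T% Y) x)
    (hZ : CMDiffAt ∞ (T% Z) x) (hW : CMDiffAt ∞ (T% W) x) :
    d% (fun y => d% (fun z => g.inner z (Z z) (W z)) y (Y y)) x (X x) =
      g.inner x (leviCivita g (fun y => leviCivita g Z y (Y y)) x (X x)) (W x)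
      + g.inner x (leviCivita g Z x (Y x)) (leviCivita g W x (X x))
      + (g.inner x (leviCivita g Z x (X x)) (leviCivita g W x (Y x))
      + g.inner x (Z x) (leviCivita g (fun y => leviCivita g W y (Y y)) x (X x))) := by
  have hX' := hX.mdifferentiableAt (by simp)
  have hZ' := hZ.mdifferentiableAt (by simp)
  have hW' := hW.mdifferentiableAt (by simp)
  have hYZ := mdifferentiableAt_leviCivita g hY hZ
  have hYW := mdifferentiableAt_leviCivita g hY hW
  rw [← mvfderiv_inner_eq g hX' hYZ hW', ← mvfderiv_inner_eq g hX' hZ' hYW]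
  have h : (fun y => d% (fun z => g.inner z (Z z) (W z)) y (Y y)) =ᶠ[𝓝 x]
      fun y => g.inner y (leviCivita g Z y (Y y)) (W y)
        + g.inner y (Z y) (leviCivita g W y (Y y)) := by
    filter_upwards [hY.eventually_mdifferentiableAt_section,
      hZ.eventually_mdifferentiableAt_section, hW.eventually_mdifferentiableAt_section]
      with y hYy hZy hWy
    exact mvfderiv_inner_eq g hYy hZy hWy
  have h' := mvfderiv_fun_add (g.mdiff hYZ hW') (g.mdiff hZ' hYW)
  rw [← _root_.add_apply, ← h', h.mvfderiv_eq]

lemma inner_curvature_swap (hX : CMDiffAt ∞ (T% X) x) (hY : CMDiffAt ∞ (T% Y) x)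
    (hZ : CMDiffAt ∞ (T% Z) x) (hW : CMDiffAt ∞ (T% W) x) :
    g.inner x (curvature g X Y Z x) (W x) = - g.inner x (curvature g X Y W x) (Z x) := by
  have h := mvfderiv_mlieBracket (g.contMDiffAt_inner hZ hW) hX hY
  rw [mvfderiv_mvfderiv_inner g hX hY hZ hW, mvfderiv_mvfderiv_inner g hY hX hZ hW,
    mvfderiv_inner_eq g ((contMDiffAt_mlieBracket hX hY).mdifferentiableAt (by simp))
      (hZ.mdifferentiableAt (by simp)) (hW.mdifferentiableAt (by simp))] at h
  simp only [curvature, map_sub, _root_.sub_apply]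
  rw [g.symm x _ (Z x), g.symm x _ (Z x), g.symm x _ (Z x)]
  linarith

omit [FiniteDimensional ℝ E] in
/-- Coordinate vector fields commute. -/
lemma mlieBracket_extend_extend (v w : TangentSpace I x) :
    mlieBracket I (FiberBundle.extend E v) (FiberBundle.extend E w) x = 0 := by
  have key (v : TangentSpace I x) : ∃ c : E, mpullbackWithin 𝓘(ℝ, E) I (extChartAt I x).symm
      (FiberBundle.extend E v : Π y : M, TangentSpace I y) (Set.range I)
      =ᶠ[𝓝[Set.range I] (extChartAt I x x)] fun _ => c := by
    refine ⟨(trivializationAt E (TangentSpace I : M → Type _) x ⟨x, v⟩).2, ?_⟩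
    filter_upwards [extChartAt_target_mem_nhdsWithin (I := I) x] with y hy
    have hs : (extChartAt I x).symm y ∈ (chartAt H x).source := by
      rw [← extChartAt_source I]; exact (extChartAt I x).map_target hy
    have h1 := TangentBundle.symmL_trivializationAt (I := I) hs
    rw [(extChartAt I x).right_inv hy] at h1
    rw [mpullbackWithin_apply, FiberBundle.extend,
      ← Bundle.Trivialization.symmL_apply (R := ℝ) _ (by exact hs), h1]
    exact (isInvertible_mfderivWithin_extChartAt_symm hy).inverse_apply_self _
  obtain ⟨c, hc⟩ := key v
  obtain ⟨d, hd⟩ := key w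
  rw [← mlieBracketWithin_univ, mlieBracketWithin_apply]
  simp only [Set.preimage_univ, Set.univ_inter]
  have hx : extChartAt I x x ∈ Set.range I := by simp [extChartAt]
  rw [hc.lieBracketWithin_vectorField_eq_of_mem hd hx]
  have h0 : lieBracketWithin ℝ (fun _ : E => c) (fun _ => d) (Set.range I) (extChartAt I x x) = 0 := by
    simp [lieBracketWithin]
  exact (congrArg _ h0).trans (map_zero _)

end Curvature

section Kaehler

variable {E : Type*} [NormedAddCommGroup E] [NormedSpace ℝ E] [FiniteDimensional ℝ E]
  {H : Type*} [TopologicalSpace H] {I : ModelWithCorners ℝ E H}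
  {M : Type*} [TopologicalSpace M] [ChartedSpace H M] [IsManifold I ∞ M]
  (A : AlmostHermitian I M) {X Y : Π x : M, TangentSpace I x} {x : M}

namespace AlmostHermitian

omit [FiniteDimensional ℝ E] in
lemma inner_J_left (x : M) (v w : TangentSpace I x) :
    A.metric.inner x (A.J x v) w = - A.metric.inner x v (A.J x w) := by
  rw [← A.metric_J, A.J_J, map_neg, _root_.neg_apply]

omit [FiniteDimensional ℝ E] in
lemma inner_J_self (x : M) (v : TangentSpace I x) : A.metric.inner x (A.J x v) v = 0 := by
  have := A.inner_J_left x v v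
  rw [A.metric.symm x v] at this
  linarith

omit [FiniteDimensional ℝ E] in
lemma mdifferentiableAt_J (hY : MDiffAt (T% Y) x) : MDiffAt (T% (fun y => A.J y (Y y))) x :=
  MDifferentiableAt.clm_bundle_apply (F₁ := E) (F₂ := E)
    (A.contMDiff_J.mdifferentiable (by simp) x) hY

omit [FiniteDimensional ℝ E] in
lemma linearIndependent_J {v : TangentSpace I x} (hv : v ≠ 0) :
    LinearIndependent ℝ ![v, A.J x v] := by
  rw [LinearIndependent.pair_iff]
  intro a b h
  have hp := A.metric.pos x v hv
  have h0 := A.inner_J_self x v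
  have h0' := h0
  rw [A.metric.symm] at h0'
  have h1 := congrArg (fun u => A.metric.inner x u v) h
  have h2 := congrArg (fun u => A.metric.inner x u (A.J x v)) h
  simp [h0, h0', A.metric_J, hp.ne'] at h1 h2
  exact ⟨h1, h2⟩

omit [FiniteDimensional ℝ E] in
/-- On a surface, a nonzero vector `v` and `J v` span the tangent space. -/
lemma exists_eq_smul_add_smul_J (hE : Module.finrank ℝ E = 2) {v : TangentSpace I x} (hv : v ≠ 0)
    (w : TangentSpace I x) : ∃ a b : ℝ, w = a • v + b • A.J x v := by
  have h := (A.linearIndependent_J hv).span_eq_top_of_card_eq_finrank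
    ((Fintype.card_fin 2).trans hE.symm)
  have hw : w ∈ Submodule.span ℝ (Set.range ![v, A.J x v]) := h ▸ Submodule.mem_top
  rw [Matrix.range_cons, Matrix.range_cons, Matrix.range_empty, Set.union_empty,
    Set.singleton_union, Submodule.mem_span_pair] at hw
  obtain ⟨a, b, h⟩ := hw
  exact ⟨a, b, h.symm⟩

lemma leviCivita_J_of_ne_zero (hE : Module.finrank ℝ E = 2) (hX : MDiffAt (T% X) x)
    (hY : MDiffAt (T% Y) x) (h0 : Y x ≠ 0) :
    leviCivita A.metric (fun y => A.J y (Y y)) x (X x)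
      = A.J x (leviCivita A.metric Y x (X x)) := by
  have hJY := A.mdifferentiableAt_J hY
  have h1 := mvfderiv_inner_eq A.metric hX hJY hY
  have h2 := mvfderiv_inner_eq A.metric hX hJY hJY
  have h3 := mvfderiv_inner_eq A.metric hX hY hY
  simp only [A.inner_J_self, mvfderiv_const, A.metric_J, _root_.zero_apply] at h1 h2
  rw [h3] at h2
  refine A.metric.eq_of_forall fun z => ?_
  obtain ⟨a, b, rfl⟩ := A.exists_eq_smul_add_smul_J hE h0 z
  have h4 := A.inner_J_left x (leviCivita A.metric Y x (X x)) (Y x)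
  have h5 := A.metric_J x (leviCivita A.metric Y x (X x)) (Y x)
  rw [A.metric.symm x (A.J x (Y x))] at h1 h2
  rw [A.metric.symm x (Y x)] at h2
  simp only [map_add, map_smul, smul_eq_mul]
  rw [h4, h5]
  have h6 : A.metric.inner x (leviCivita A.metric (fun y ↦ A.J y (Y y)) x (X x)) (A.J x (Y x)) =
    A.metric.inner x (leviCivita A.metric Y x (X x)) (Y x) := by linarith
  rw [h6]
  linear_combination a * (-h1)

/-- Every almost Hermitian surface is Kähler. -/
theorem isKaehler_of_finrank_eq_two (hE : Module.finrank ℝ E = 2) : A.IsKaehler := by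
  intro X Y hX hY x
  have hX' := (hX x).mdifferentiableAt (n := ∞) (by simp)
  have hY' := (hY x).mdifferentiableAt (n := ∞) (by simp)
  by_cases h0 : Y x = 0
  · have : Nontrivial (TangentSpace I x) :=
      Module.nontrivial_of_finrank_pos (R := ℝ) (M := E) (by omega)
    obtain ⟨v, hv⟩ := exists_ne (0 : TangentSpace I x)
    let V : Π y : M, TangentSpace I y := FiberBundle.extend E v
    have hV : MDiffAt (T% V) x := FiberBundle.mdifferentiableAt_extend ..
    have hVx : V x = v := FiberBundle.extend_apply_self E v
    have h1 := A.leviCivita_J_of_ne_zero hE hX' hV (by rwa [hVx])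
    have h2 := A.leviCivita_J_of_ne_zero hE hX' (mdifferentiableAt_add_section hY' hV)
      (by rwa [Pi.add_apply, h0, zero_add, hVx])
    have h3 : (fun y => A.J y ((Y + V) y)) = (fun y => A.J y (Y y)) + fun y => A.J y (V y) := by
      ext y; simp
    rw [h3, (leviCivita A.metric).isCovariantDerivativeOn.add (A.mdifferentiableAt_J hY')
      (A.mdifferentiableAt_J hV), (leviCivita A.metric).isCovariantDerivativeOn.add hY' hV,
      _root_.add_apply, _root_.add_apply, map_add, h1] at h2
    exact add_right_cancel h2
  · exact A.leviCivita_J_of_ne_zero hE hX' hY' h0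

end AlmostHermitian

end Kaehler

section WarpedCurvature

variable {E : Type*} [NormedAddCommGroup E] [NormedSpace ℝ E]
  {H : Type*} [TopologicalSpace H] {I : ModelWithCorners ℝ E H}
  {N : Type*} [TopologicalSpace N] [ChartedSpace H N] [IsManifold I ∞ N]
  {U : TopologicalSpace.Opens ℝ} {p : U × N}

/-- The coordinate fields of a product chart are the products of the coordinate fields. -/
lemma eventually_extend_prod (v : TangentSpace (𝓘(ℝ, ℝ).prod I) p) :
    ∀ᶠ q : U × N in 𝓝 p,
      dTheta I q (FiberBundle.extend (E := TangentSpace (𝓘(ℝ, ℝ).prod I)) (ℝ × E) v q)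
        = dTheta I p v ∧
      dProj I q (FiberBundle.extend (E := TangentSpace (𝓘(ℝ, ℝ).prod I)) (ℝ × E) v q)
        = (FiberBundle.extend E (dProj I p v) : Π y : N, TangentSpace I y) q.2 := by
  filter_upwards [eventually_mem_chartAt_source (H' := ModelProd ℝ H) p] with q hq
  have hq' := hq
  rw [prodChartedSpace_chartAt, OpenPartialHomeomorph.prod_source] at hq'
  have hp : p ∈ (chartAt (ModelProd ℝ H) p).source := mem_chart_source _ p
  let t := trivializationAt (ℝ × E) (TangentSpace (𝓘(ℝ, ℝ).prod I) : U × N → Type _) p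
  let s := trivializationAt E (TangentSpace I : N → Type _) p.2
  have h1 : (t ⟨p, v⟩).2 = (v.1, (s ⟨p.2, v.2⟩).2) := by
    have h := warped_continuousLinearMapAt (I := I) p p hp v
    rw [Bundle.Trivialization.continuousLinearMapAt_apply_of_mem (R := ℝ) (hb := hp)] at h
    exact h.trans (Prod.ext rfl (Bundle.Trivialization.continuousLinearMapAt_apply_of_mem ℝ s
      (show p.2 ∈ s.baseSet from mem_chart_source H p.2) _))
  have h2 : FiberBundle.extend (E := TangentSpace (𝓘(ℝ, ℝ).prod I)) (ℝ × E) v q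
      = ((v.1, s.symm q.2 (s ⟨p.2, v.2⟩).2) : ℝ × E) := by
    have h := warped_symmL (I := I) p q hq (t ⟨p, v⟩).2
    rw [Bundle.Trivialization.symmL_apply (R := ℝ) _ (show q ∈ t.baseSet from hq), h1,
      Bundle.Trivialization.symmL_apply (R := ℝ) _ (show q.2 ∈ s.baseSet from hq'.2)] at h
    rw [FiberBundle.extend]
    change t.symm q (t ⟨p, v⟩).2 = _
    rw [h1]
    exact h
  rw [h2]
  exact ⟨rfl, rfl⟩

lemma eventually_partialTheta_eq_extend (p : U × N) :
    (partialTheta I : Π q : U × N, TangentSpace (𝓘(ℝ, ℝ).prod I) q) =ᶠ[𝓝 p]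
      FiberBundle.extend (E := TangentSpace (𝓘(ℝ, ℝ).prod I)) (ℝ × E) (partialTheta I p) := by
  filter_upwards [eventually_extend_prod (partialTheta I p),
    eventually_mem_chartAt_source (H' := ModelProd ℝ H) p] with q ⟨h1, h2⟩ hq
  rw [prodChartedSpace_chartAt, OpenPartialHomeomorph.prod_source] at hq
  refine tangent_ext (h1.trans ?_).symm (h2.trans ?_).symm
  · simp
  · rw [dProj_partialTheta, dProj_partialTheta, FiberBundle.extend,
      ← Bundle.Trivialization.symmL_apply (R := ℝ) _ (by exact hq.2),
      ← Bundle.Trivialization.continuousLinearMapAt_apply_of_mem (R := ℝ)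
        (hb := mem_chart_source H p.2), map_zero, map_zero]

omit [IsManifold I ∞ N] in
lemma contMDiff_theta : ContMDiff (𝓘(ℝ, ℝ).prod I) 𝓘(ℝ, ℝ) ∞ (fun q : U × N ↦ (q.1 : ℝ)) :=
  contMDiff_subtype_val.comp contMDiff_fst

omit [IsManifold I ∞ N] in
/-- The derivative of a function of `θ`. -/
lemma mvfderiv_comp_theta {h : ℝ → ℝ} {h' : ℝ} (hh : HasDerivAt h h' p.1)
    (v : TangentSpace (𝓘(ℝ, ℝ).prod I) p) :
    MDifferentiableAt (𝓘(ℝ, ℝ).prod I) 𝓘(ℝ, ℝ) (fun q : U × N ↦ h q.1) p ∧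
    mvfderiv (𝓘(ℝ, ℝ).prod I) (fun q : U × N ↦ h q.1) p v = h' * dTheta I p v := by
  have h1 : MDifferentiableAt (𝓘(ℝ, ℝ).prod I) 𝓘(ℝ, ℝ) (fun q : U × N ↦ (q.1 : ℝ)) p :=
    contMDiff_theta.mdifferentiable (by simp) p
  have h2 : MDifferentiableAt 𝓘(ℝ, ℝ) 𝓘(ℝ, ℝ) h p.1 := hh.differentiableAt.mdifferentiableAt
  refine ⟨h2.comp p h1, ?_⟩
  refine (mvfderiv_comp_apply (I := 𝓘(ℝ, ℝ)) (I' := 𝓘(ℝ, ℝ).prod I) (f := fun q : U × N ↦ (q.1 : ℝ))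
    p h2 h1 v).trans ?_
  have h3 : mvfderiv 𝓘(ℝ, ℝ) h p.1 = fderiv ℝ h p.1 := by
    rw [mvfderiv, mfderiv_eq_fderiv]; rfl
  have h4 : dTheta I p v = mfderiv (𝓘(ℝ, ℝ).prod I) 𝓘(ℝ, ℝ) (fun q : U × N ↦ (q.1 : ℝ)) p v :=
    congr($(dTheta_eq_mvfderiv p) v)
  rw [h4, h3, hh.hasFDerivAt.fderiv]
  exact mul_comm _ _

omit [IsManifold I ∞ N] in
lemma mvfderiv_comp_snd_partialTheta {b : N → ℝ} (hb : MDifferentiableAt I 𝓘(ℝ, ℝ) b p.2) :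
    mvfderiv (𝓘(ℝ, ℝ).prod I) (fun q : U × N ↦ b q.2) p (partialTheta I p) = 0 := by
  refine (mvfderiv_comp_apply (I := I) (I' := 𝓘(ℝ, ℝ).prod I) (f := (Prod.snd : U × N → N))
    p hb mdifferentiableAt_snd (partialTheta I p)).trans ?_
  rw [← dProj_eq_mfderiv, dProj_partialTheta, map_zero]

variable [FiniteDimensional ℝ E] (g : RiemannianMetricOn I N) {f : ℝ → ℝ}
  (hf : ContDiffOn ℝ ∞ f U) (hpos : ∀ t ∈ U, 0 < f t)

omit [FiniteDimensional ℝ E] in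
lemma warpedMetric_inner_partialTheta (v : TangentSpace (𝓘(ℝ, ℝ).prod I) p) :
    (warpedMetric g f hf hpos).inner p (partialTheta I p) v = dTheta I p v := by
  change warpedInner g f p _ _ = _
  simp [warpedInner_apply]

lemma hasDerivAt_of_contDiffOn {t : ℝ} (hf : ContDiffOn ℝ ∞ f U) (ht : t ∈ U) :
    HasDerivAt f (deriv f t) t :=
  ((hf.contDiffAt (U.isOpen.mem_nhds ht)).differentiableAt (by simp)).hasDerivAt

/-- `∇_v ∂_θ = (f' / f) (v - dθ(v) ∂_θ)`. -/
lemma leviCivita_partialTheta (v : TangentSpace (𝓘(ℝ, ℝ).prod I) p) :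
    leviCivita (warpedMetric g f hf hpos) (partialTheta I) p v =
      (deriv f p.1 / f p.1) • (v - dTheta I p v • partialTheta I p) := by
  refine (warpedMetric g f hf hpos).eq_of_forall fun z => ?_
  let V : Π q : U × N, TangentSpace (𝓘(ℝ, ℝ).prod I) q := FiberBundle.extend (ℝ × E) v
  let Z : Π q : U × N, TangentSpace (𝓘(ℝ, ℝ).prod I) q := FiberBundle.extend (ℝ × E) z
  let B : N → ℝ := fun y => g.inner y
    (FiberBundle.extend (E := TangentSpace I) E (dProj I p v) y)
    (FiberBundle.extend (E := TangentSpace I) E (dProj I p z) y)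
  have hV : MDiffAt (T% V) p := FiberBundle.mdifferentiableAt_extend ..
  have hZ : MDiffAt (T% Z) p := FiberBundle.mdifferentiableAt_extend ..
  have hVp : V p = v := FiberBundle.extend_apply_self _ v
  have hZp : Z p = z := FiberBundle.extend_apply_self _ z
  have hξ := contMDiff_partialTheta.mdifferentiable (n := ∞) (I := 𝓘(ℝ, ℝ).prod I) (by simp) p
  have hB : MDifferentiableAt I 𝓘(ℝ, ℝ) B p.2 :=
    g.mdiff (FiberBundle.mdifferentiableAt_extend ..) (FiberBundle.mdifferentiableAt_extend ..)
  have hfp : f p.1 ≠ 0 := (hpos _ p.1.2).ne'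
  have hf2 := mvfderiv_comp_theta (I := I) (p := p)
    ((hasDerivAt_of_contDiffOn hf p.1.2).fun_pow 2) (partialTheta I p)
  have hB2 : MDifferentiableAt (𝓘(ℝ, ℝ).prod I) 𝓘(ℝ, ℝ) (fun q : U × N ↦ B q.2) p :=
    hB.comp p mdifferentiableAt_snd
  have key := two_mul_inner_leviCivita (warpedMetric g f hf hpos) hV hξ hZ
  have hev := eventually_partialTheta_eq_extend (I := I) p
  have e1 : (fun q => (warpedMetric g f hf hpos).inner q (partialTheta I q) (Z q)) =ᶠ[𝓝 p]
      fun _ => dTheta I p z := by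
    filter_upwards [eventually_extend_prod z] with q hq
    rw [warpedMetric_inner_partialTheta]
    exact hq.1
  have e2 : (fun q => (warpedMetric g f hf hpos).inner q (V q) (partialTheta I q)) =ᶠ[𝓝 p]
      fun _ => dTheta I p v := by
    filter_upwards [eventually_extend_prod v] with q hq
    rw [(warpedMetric g f hf hpos).symm, warpedMetric_inner_partialTheta]
    exact hq.1
  have e3 : (fun q => (warpedMetric g f hf hpos).inner q (V q) (Z q)) =ᶠ[𝓝 p]
      fun q => dTheta I p v * dTheta I p z + f q.1 ^ 2 * B q.2 := by
    filter_upwards [eventually_extend_prod v, eventually_extend_prod z] with q hq hq'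
    change warpedInner g f q (V q) (Z q) = _
    rw [warpedInner_apply, hq.1, hq.2, hq'.1, hq'.2]
  have e4 : mvfderiv (𝓘(ℝ, ℝ).prod I)
      (fun q : U × N => dTheta I p v * dTheta I p z + f q.1 ^ 2 * B q.2) p =
      mvfderiv (𝓘(ℝ, ℝ).prod I) (fun q : U × N => f q.1 ^ 2 * B q.2) p := by
    rw [mvfderiv_fun_add mdifferentiableAt_const (by exact hf2.1.mul hB2), mvfderiv_const, zero_add]
  have b1 : mlieBracket (𝓘(ℝ, ℝ).prod I) V (partialTheta I) p = 0 := by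
    rw [Filter.EventuallyEq.mlieBracket_vectorField_eq (V := V) Filter.EventuallyEq.rfl hev]
    exact mlieBracket_extend_extend v _
  have b2 : mlieBracket (𝓘(ℝ, ℝ).prod I) (partialTheta I) Z p = 0 := by
    rw [Filter.EventuallyEq.mlieBracket_vectorField_eq (W := Z) hev Filter.EventuallyEq.rfl]
    exact mlieBracket_extend_extend _ z
  have b3 : mlieBracket (𝓘(ℝ, ℝ).prod I) V Z p = 0 := mlieBracket_extend_extend v z
  rw [koszul, b1, b2, b3, e1.mvfderiv_eq, e2.mvfderiv_eq, e3.mvfderiv_eq, mvfderiv_const,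
    mvfderiv_const, e4, mvfderiv_fun_mul hf2.1 hB2] at key
  simp only [hVp, hZp, map_zero, _root_.zero_apply, _root_.add_apply, _root_.smul_apply,
    hf2.2, mvfderiv_comp_snd_partialTheta hB, dTheta_partialTheta] at key
  have hBp : B p.2 = g.inner p.2 (dProj I p v) (dProj I p z) := by
    simp only [B, FiberBundle.extend_apply_self]
  rw [hBp] at key
  have hr : (warpedMetric g f hf hpos).inner p
      ((deriv f p.1 / f p.1) • (v - dTheta I p v • partialTheta I p)) z =
      (deriv f p.1 / f p.1) * (f p.1 ^ 2 * g.inner p.2 (dProj I p v) (dProj I p z)) := by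
    change warpedInner g f p _ _ = _
    simp [warpedInner_apply]
  rw [hr]
  simp at key
  field_simp
  linarith

end WarpedCurvature

section WarpedIdentity

variable {E : Type*} [NormedAddCommGroup E] [NormedSpace ℝ E] [FiniteDimensional ℝ E]
  {H : Type*} [TopologicalSpace H] {I : ModelWithCorners ℝ E H}
  {N : Type*} [TopologicalSpace N] [ChartedSpace H N] [IsManifold I ∞ N]
  {U : TopologicalSpace.Opens ℝ} {p : U × N}

section

variable (g : RiemannianMetricOn I N) {f : ℝ → ℝ}
  (hf : ContDiffOn ℝ ∞ f U) (hpos : ∀ t ∈ U, 0 < f t)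
  {X Y Z W : Π q : U × N, TangentSpace (𝓘(ℝ, ℝ).prod I) q}

omit [FiniteDimensional ℝ E] in
lemma mdifferentiableAt_dTheta (hX : CMDiffAt ∞ (T% X) p) :
    MDiffAt (fun q => dTheta I q (X q)) p := by
  simp only [dTheta_eq_mvfderiv]
  exact (contMDiff_theta.contMDiffAt.mvfderiv_apply hX).mdifferentiableAt (by simp)

lemma dTheta_mlieBracket (hX : CMDiffAt ∞ (T% X) p) (hY : CMDiffAt ∞ (T% Y) p) :
    dTheta I p (mlieBracket (𝓘(ℝ, ℝ).prod I) X Y p) =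
      d% (fun q => dTheta I q (Y q)) p (X p) - d% (fun q => dTheta I q (X q)) p (Y p) := by
  simp only [dTheta_eq_mvfderiv]
  exact mvfderiv_mlieBracket contMDiff_theta.contMDiffAt hX hY

lemma hasDerivAt_logDeriv_of_ode {t : ℝ} (ht : t ∈ U) (hf : ContDiffOn ℝ ∞ f U) (h0 : f t ≠ 0)
    (hode : deriv (deriv f) t = -f t) :
    HasDerivAt (fun s => deriv f s / f s) (-1 - (deriv f t / f t) ^ 2) t := by
  have h1 := hasDerivAt_of_contDiffOn hf ht
  have h2 : HasDerivAt (deriv f) (-f t) t := by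
    rw [← hode]
    exact (((hf.deriv_of_isOpen (m := ∞) U.isOpen (by simp)).contDiffAt
      (U.isOpen.mem_nhds ht)).differentiableAt (by simp)).hasDerivAt
  refine (h2.fun_div h1 h0).congr_deriv ?_
  field_simp

lemma leviCivita_leviCivita_partialTheta (hY : CMDiffAt ∞ (T% Y) p)
    (hode : ∀ t ∈ U, deriv (deriv f) t = -f t) :
    leviCivita (warpedMetric g f hf hpos)
        (fun q => leviCivita (warpedMetric g f hf hpos) (partialTheta I) q (Y q)) p (X p) =
      (deriv f p.1 / f p.1) • (leviCivita (warpedMetric g f hf hpos) Y p (X p)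
        - d% (fun q => dTheta I q (Y q)) p (X p) • partialTheta I p
        - dTheta I p (Y p) • (deriv f p.1 / f p.1) • (X p - dTheta I p (X p) • partialTheta I p))
      + ((-1 - (deriv f p.1 / f p.1) ^ 2) * dTheta I p (X p)) •
        (Y p - dTheta I p (Y p) • partialTheta I p) := by
  let h : U × N → ℝ := fun q => deriv f q.1 / f q.1
  let b : U × N → ℝ := fun q => dTheta I q (Y q)
  have h1 : (fun q => leviCivita (warpedMetric g f hf hpos) (partialTheta I) q (Y q)) =
      h • (Y + (-b) • partialTheta I) := by
    ext1 q
    rw [leviCivita_partialTheta]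
    simp [h, b, sub_eq_add_neg]
  obtain ⟨hh, hh'⟩ : MDiffAt h p ∧ d% h p (X p) = _ := mvfderiv_comp_theta (I := I) (p := p)
    (hasDerivAt_logDeriv_of_ode p.1.2 hf (hpos _ p.1.2).ne' (hode _ p.1.2)) (X p)
  have hb : MDiffAt b p := mdifferentiableAt_dTheta hY
  have hY' := hY.mdifferentiableAt (by simp)
  have hξ := contMDiff_partialTheta.mdifferentiable (n := ∞) (I := 𝓘(ℝ, ℝ).prod I) (by simp) p
  have hbξ := hb.neg.smul_section hξ
  have hC := (leviCivita (warpedMetric g f hf hpos)).isCovariantDerivativeOn (s := Set.univ)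
  rw [h1, hC.leibniz (mdifferentiableAt_add_section hY' hbξ) hh, hC.add hY' hbξ,
    hC.leibniz hξ hb.neg]
  simp only [_root_.add_apply, _root_.smul_apply, ContinuousLinearMap.smulRight_apply,
    hh', leviCivita_partialTheta, Pi.add_apply, Pi.smul_apply', Pi.neg_apply, mvfderiv_neg,
    _root_.neg_apply]
  module

/-- `R_{XY} ∂_θ = dθ(Y) X - dθ(X) Y` when `f'' = -f`. -/
lemma curvature_partialTheta (hX : CMDiffAt ∞ (T% X) p) (hY : CMDiffAt ∞ (T% Y) p)
    (hode : ∀ t ∈ U, deriv (deriv f) t = -f t) :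
    curvature (warpedMetric g f hf hpos) X Y (partialTheta I) p =
      dTheta I p (Y p) • X p - dTheta I p (X p) • Y p := by
  rw [curvature, leviCivita_leviCivita_partialTheta g hf hpos hY hode,
    leviCivita_leviCivita_partialTheta g hf hpos hX hode, leviCivita_partialTheta,
    dTheta_mlieBracket hX hY, ← leviCivita_sub_swap (warpedMetric g f hf hpos)
      (hX.mdifferentiableAt (by simp)) (hY.mdifferentiableAt (by simp))]
  module

end

omit [FiniteDimensional ℝ E] in
/-- A skew form on `ℝ ⊕ T_x N` annihilated by `∂_θ` is invariant under `φ`,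
if `N` is a surface. -/
lemma skew_form_warpedPhi (A : AlmostHermitian I N) (hE : Module.finrank ℝ E = 2)
    (b : TangentSpace (𝓘(ℝ, ℝ).prod I) p → TangentSpace (𝓘(ℝ, ℝ).prod I) p →L[ℝ] ℝ)
    (hb : ∀ v w, b v w = - b w v) (hξ : ∀ w, b (partialTheta I p) w = 0)
    (v w : TangentSpace (𝓘(ℝ, ℝ).prod I) p) :
    b (warpedPhi A.J p v) (warpedPhi A.J p w) = b v w := by
  have : Nontrivial (TangentSpace I p.2) :=
    Module.nontrivial_of_finrank_pos (R := ℝ) (M := E) (by omega)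
  obtain ⟨e, he⟩ := exists_ne (0 : TangentSpace I p.2)
  have hdec (v : TangentSpace (𝓘(ℝ, ℝ).prod I) p) : ∃ t x y : ℝ,
      v = t • partialTheta I p + x • dIncl I p e + y • dIncl I p (A.J p.2 e) ∧
      warpedPhi A.J p v = x • dIncl I p (A.J p.2 e) - y • dIncl I p e := by
    obtain ⟨x, y, h⟩ := A.exists_eq_smul_add_smul_J hE he (dProj I p v)
    refine ⟨dTheta I p v, x, y, tangent_ext ?_ ?_, ?_⟩
    · simp
    · simp [h]
    · simp [warpedPhi, h, A.J_J, sub_eq_add_neg]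
  have hξ' (w) : b w (partialTheta I p) = 0 := by rw [hb, hξ, neg_zero]
  have hself (w) : b w w = 0 := by have := hb w w; linarith
  obtain ⟨t, x, y, hv, hv'⟩ := hdec v
  obtain ⟨t', x', y', hw, hw'⟩ := hdec w
  have hadd (u z s) : b (u + z) s = b u s + b z s := by
    rw [hb, map_add, hb u, hb z, neg_add]
  have hsmul (c : ℝ) (u s) : b (c • u) s = c * b u s := by
    rw [hb, map_smul, hb u, smul_eq_mul, mul_neg]
  have hskew := hb (dIncl I p (A.J p.2 e)) (dIncl I p e)
  rw [hv', hw', hv, hw, sub_eq_add_neg, sub_eq_add_neg, ← neg_smul, ← neg_smul]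
  simp only [hadd, hsmul, map_add, map_smul, smul_eq_mul, hξ, hξ', hself, hskew]
  ring

theorem AlmostHermitian.warpedProduct_satisfiesG1 (A : AlmostHermitian I N)
    (hE : Module.finrank ℝ E = 2) (f : ℝ → ℝ) (hf : ContDiffOn ℝ ∞ f U)
    (hpos : ∀ t ∈ U, 0 < f t) (hode : ∀ t ∈ U, deriv (deriv f) t = -f t) :
    (A.warpedProduct U f hf hpos).SatisfiesG1 := by
  intro X Y Z W hX hY hZ hW p
  let g := warpedMetric A.metric f hf hpos
  let b : TangentSpace (𝓘(ℝ, ℝ).prod I) p → TangentSpace (𝓘(ℝ, ℝ).prod I) p →L[ℝ] ℝ := fun v =>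
    g.inner p (curvature g X Y
      (FiberBundle.extend (E := TangentSpace (𝓘(ℝ, ℝ).prod I)) (ℝ × E) v) p
      + g.inner p (X p) v • Y p - g.inner p (Y p) v • X p)
  have hC {Z W : Π q : U × N, TangentSpace (𝓘(ℝ, ℝ).prod I) q}
      (hZ : CMDiffAt ∞ (T% Z) p) (hW : CMDiffAt ∞ (T% W) p) :=
    inner_curvature_swap g (hX p) (hY p) hZ hW
  have hext (v : TangentSpace (𝓘(ℝ, ℝ).prod I) p) :
      CMDiffAt ∞ (T% (FiberBundle.extend (E := TangentSpace (𝓘(ℝ, ℝ).prod I)) (ℝ × E) v)) p :=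
    FiberBundle.contMDiffAt_extend ..
  have hb {Z W : Π q : U × N, TangentSpace (𝓘(ℝ, ℝ).prod I) q}
      (hZ : CMDiffAt ∞ (T% Z) p) (hW : CMDiffAt ∞ (T% W) p) :
      g.inner p (curvature g X Y Z p) (W p) = b (Z p) (W p)
        - g.inner p (X p) (Z p) * g.inner p (Y p) (W p)
        + g.inner p (Y p) (Z p) * g.inner p (X p) (W p) := by
    have h1 := hC hZ (hext (W p))
    have h2 := hC (hext (Z p)) (hext (W p))
    have h3 := hC (hext (W p)) hZ
    simp only [FiberBundle.extend_apply_self] at h1 h2 h3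
    simp only [b, map_add, map_sub, map_smul, _root_.add_apply, _root_.sub_apply,
      _root_.smul_apply, smul_eq_mul]
    linarith
  have hskew (v w) : b v w = - b w v := by
    have h2 := hC (hext v) (hext w)
    simp only [FiberBundle.extend_apply_self] at h2
    simp only [b, map_add, map_sub, map_smul, _root_.add_apply, _root_.sub_apply,
      _root_.smul_apply, smul_eq_mul]
    linarith
  have hξ (w) : b (partialTheta I p) w = 0 := by
    have h1 := hb (contMDiff_partialTheta p) (hext w)
    rw [curvature_partialTheta A.metric hf hpos (hX p) (hY p) hode] at h1
    rw [g.symm p (X p) (partialTheta I p), g.symm p (Y p) (partialTheta I p),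
      warpedMetric_inner_partialTheta, warpedMetric_inner_partialTheta] at h1
    simp only [FiberBundle.extend_apply_self, map_sub, map_smul, _root_.sub_apply,
      _root_.smul_apply, smul_eq_mul] at h1
    linarith
  have hφ {Z : Π q : U × N, TangentSpace (𝓘(ℝ, ℝ).prod I) q} (hZ : CMDiffAt ∞ (T% Z) p) :
      CMDiffAt ∞ (T% (fun q => warpedPhi A.J q (Z q))) p :=
    ContMDiffAt.clm_bundle_apply (F₁ := ℝ × E) (F₂ := ℝ × E) (contMDiff_warpedPhi A p) hZ
  have h1 := hb (hZ p) (hW p)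
  have h2 := hb (hφ (hZ p)) (hφ (hW p))
  have h3 := skew_form_warpedPhi A hE b hskew hξ (Z p) (W p)
  change - g.inner p (curvature g X Y (fun q => warpedPhi A.J q (Z q)) p) (warpedPhi A.J p (W p))
    - - g.inner p (curvature g X Y Z p) (W p) =
    g.inner p (Y p) (warpedPhi A.J p (W p)) * g.inner p (X p) (warpedPhi A.J p (Z p))
      - g.inner p (X p) (warpedPhi A.J p (W p)) * g.inner p (Y p) (warpedPhi A.J p (Z p))
      + g.inner p (X p) (W p) * g.inner p (Y p) (Z p)
      - g.inner p (Y p) (W p) * g.inner p (X p) (Z p)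
  rw [h1, h2, h3]
  ring

end WarpedIdentity

theorem mainTheorem11 {N : Type*} [TopologicalSpace N] [T2Space N]
    [ChartedSpace (EuclideanSpace ℝ (Fin 2)) N] [IsManifold (𝓡 2) ∞ N]
    (A : AlmostHermitian (𝓡 2) N)
    (U : TopologicalSpace.Opens ℝ) (f : ℝ → ℝ)
    (hf : ContDiffOn ℝ ∞ f U) (hpos : ∀ t ∈ U, 0 < f t)
    (hode : ∀ t ∈ U, deriv (deriv f) t = -f t) :
    A.IsKaehler ∧ (A.warpedProduct U f hf hpos).SatisfiesG1 :=
  ⟨A.isKaehler_of_finrank_eq_two (by simp), A.warpedProduct_satisfiesG1 (by simp) f hf hpos hode⟩
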